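/- Let $n\ge 1$ be an integer, let $\gamma,\delta>0$ and $p_{11n}\in(0,1)$, and set $$q_{1n}=1-(1+\gamma)p_{11n},\qquad q_{2n}=1-(1+\delta)p_{11n},\qquad p_{00n}=1-(1+\gamma+\delta)p_{11n},$$ where $p_{00n}>0$. Let $\mathbf X_1,\dots,\mathbf X_n$ be i.i.d. random pairs in $\mathbb Z_+^2$ with the Marshall–Olkin geometric distribution with parameters $q_{1n},q_{2n},p_{00n}$, i.e. (omitting the subscript $n$ of the parameters) $$P(\mathbf X_i=(k,l))=\begin{cases}p_{00}^k\,q_2^{\,l-k}\,(1-p_{00}/q_2-q_2+p_{00}), & k<l,\\ p_{00}^k\,(1-q_1-q_2+p_{00}), & k=l,\\ p_{00}^l\,q_1^{\,k-l}\,(1-q_1-p_{00}/q_1+p_{00}), & k>l.\end{cases}$$ Let $\mathbf X_i^\star=\log(1/p_{00n})\,\mathbf X_i-(\log n,\log n)$, let $u_n^\star\ge-\log n$, $A^\star=[u_n^\star,\infty)^2$, and let $\Xi^\star_{A^\star}=\sum_{i=1}^n I_{\{\mathbf X_i^\star\in A^\star\}}\,\delta_{\mathbf X_i^\star}$ be the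 marked point process of joint exceedances of $u_n^\star$. Let $\boldsymbol\lambda^\star_{\gamma,\delta}$ be the measure on $A^\star$ given by $$\boldsymbol\lambda^\star_{\gamma,\delta}(B)=\iint_{B}\lambda^\star_{\gamma,\delta}(s,t)\,ds\,dt+\int_{\{s:\,(s,s)\in B\}}\frac{e^{-s}}{1+\gamma+\delta}\,ds,$$ $$\lambda^\star_{\gamma,\delta}(s,t)=\begin{cases}\dfrac{\gamma(1+\delta)}{(1+\gamma+\delta)^2}\,e^{-\frac{\gamma}{1+\gamma+\delta}s}\,e^{-\frac{1+\delta}{1+\gamma+\delta}t}, & s<t,\\[2ex] \dfrac{\delta(1+\gamma)}{(1+\gamma+\delta)^2}\,e^{-\frac{1+\gamma}{1+\gamma+\delta}s}\,e^{-\frac{\delta}{1+\gamma+\delta}t}, & s>t,\end{cases}$$ and let $\mathrm{PRM}(\boldsymbol\lambda^\star_{\gamma,\delta})$ be the law of the Poisson process on $A^\star$ with mean measure $\boldsymbol\lambda^\star_{\gamma,\delta}$. Then $$d_2\bigl(\mathcal L(\Xi^\star_{A^\star}),\mathrm{PRM}(\boldsymbol\lambda^\star_{\gamma,\delta})\bigr)\le\frac{e^{-u_n^\star}}{n}+\frac{(1+\gamma+\delta)^2p_{11n}}{[1-(1+\gamma+\delta)p_{11n}]^3}\Bigl\{2\sqrt2+7\bigl(e^{-u_n^\star}\wedge1.65\,e^{-u_n^\star/2}\bigr)\Bigr\}.$$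 Here $d_0(z,w)=\min(|z-w|,1)$ with the Euclidean norm; for finite point measures $\xi,\eta$ on $A^\star$, $d_1(\xi,\eta)=1$ if $\xi(A^\star)\ne\eta(A^\star)$, and otherwise $d_1(\xi,\eta)=\xi(A^\star)^{-1}\sup_\kappa|\int\kappa\,d\xi-\int\kappa\,d\eta|$ over all $\kappa:A^\star\to\mathbb R$ with $|\kappa(z)-\kappa(w)|\le d_0(z,w)$ (and $d_1(0,0)=0$); and $d_2(\mu,\nu)=\sup_h|\int h\,d\mu-\int h\,d\nu|$ over all measurable real functions $h$ on the space of finite point measures on $A^\star$ with $|h(\xi)-h(\eta)|\le d_1(\xi,\eta)$. -/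

import Mathlib

open MeasureTheory ProbabilityTheory
open scoped ENNReal Nat

namespace PointProcess

section General

variable {E : Type*} [MeasurableSpace E]

/-- A finite point measure: a finite sum of Dirac measures at not necessarily distinct points. -/
def IsPointMeasure (ξ : Measure E) : Prop :=
  ∃ (m : ℕ) (z : Fin m → E), ξ = ∑ i, Measure.dirac (z i)

/-- The space `M_p(E)` of finite point measures on `E`. -/
def PointMeasure (E : Type*) [MeasurableSpace E] : Type _ :=
  {ξ : Measure E // IsPointMeasure ξ}

/-- The smallest `σ`-algebra on `M_p(E)` that makes all evaluations `ξ ↦ ξ B`, for measurable `B`,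
measurable (this is how Mathlib's `σ`-algebra on `Measure E` is defined). -/
instance : MeasurableSpace (PointMeasure E) :=
  inferInstanceAs (MeasurableSpace {ξ : Measure E // IsPointMeasure ξ})

/-- The point configuration `∑ δ_{z i}`. -/
noncomputable def config {m : ℕ} (z : Fin m → E) : PointMeasure E :=
  ⟨∑ i, Measure.dirac (z i), m, z, rfl⟩

lemma measurable_eval {B : Set E} (hB : MeasurableSet B) :
    Measurable fun ξ : PointMeasure E ↦ ξ.1 B :=
  (Measure.measurable_coe hB).comp measurable_subtype_coe

lemma measurable_config (m : ℕ) : Measurable (config : (Fin m → E) → PointMeasure E) := by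
  refine Measurable.subtype_mk (Measure.measurable_of_measurable_coe _ fun s hs ↦ ?_)
  simp only [Measure.finsetSum_apply]
  exact Finset.measurable_sum _ fun i _ ↦
    (Measure.measurable_coe hs).comp (Measure.measurable_dirac.comp (measurable_pi_apply i))

lemma isPointMeasure_zero : IsPointMeasure (0 : Measure E) :=
  ⟨0, Fin.elim0, by simp⟩

lemma isPointMeasure_dirac (z : E) : IsPointMeasure (Measure.dirac z) :=
  ⟨1, fun _ ↦ z, by simp⟩

lemma IsPointMeasure.add {ξ η : Measure E} (hξ : IsPointMeasure ξ) (hη : IsPointMeasure η) :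
    IsPointMeasure (ξ + η) := by
  obtain ⟨m, z, rfl⟩ := hξ
  obtain ⟨k, w, rfl⟩ := hη
  exact ⟨m + k, Fin.append z w, by simp [Fin.sum_univ_add]⟩

lemma isPointMeasure_sum {ι : Type*} (s : Finset ι) {ξ : ι → Measure E}
    (h : ∀ i ∈ s, IsPointMeasure (ξ i)) : IsPointMeasure (∑ i ∈ s, ξ i) :=
  Finset.sum_induction ξ IsPointMeasure (fun _ _ ↦ IsPointMeasure.add) isPointMeasure_zero h

open Classical in
/-- The part in `A` of the configuration of the points `x 1, …, x n`, as a point measure on `A`: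
`∑ i, I_{x i ∈ A} δ_{x i}`. -/
noncomputable def configIn {n : ℕ} (A : Set E) (x : Fin n → E) : PointMeasure A :=
  ⟨∑ i, if h : x i ∈ A then Measure.dirac (⟨x i, h⟩ : A) else 0, isPointMeasure_sum _ fun i _ ↦ by
    by_cases h : x i ∈ A
    · simpa [h] using isPointMeasure_dirac _
    · simpa [h] using isPointMeasure_zero⟩

/-- `Q` is the law of a Poisson process with finite mean measure `lam`: the number of points in
`B` is Poisson distributed with mean `lam B`, and the numbers of points in mutually disjoint sets
are independent. -/
structure IsPoissonLaw (lam : Measure E) (Q : Measure (PointMeasure E)) : Prop where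
  isProbabilityMeasure : IsProbabilityMeasure Q
  map_eval : ∀ B : Set E, MeasurableSet B →
    Q.map (fun ξ ↦ ξ.1 B) = (poissonMeasure (lam B).toNNReal).map (Nat.cast : ℕ → ℝ≥0∞)
  indep : ∀ (m : ℕ) (B : Fin m → Set E), (∀ i, MeasurableSet (B i)) →
    Pairwise (fun i j ↦ Disjoint (B i) (B j)) → iIndepFun (fun i (ξ : PointMeasure E) ↦ ξ.1 (B i)) Q

/-- `PRM(lam)`, the law of the Poisson process with finite mean measure `lam`:
`PRM(lam)(R) = e^{-lam(E)} ∑_k (1/k!) ∫_{E^k} I_{δ_{z_1} + ⋯ + δ_{z_k} ∈ R} lam(dz_1) ⋯ lam(dz_k)`.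
The theorem `isPoissonLaw_PRM` below shows that it has the properties that define that law. -/
noncomputable def PRM (lam : Measure E) : Measure (PointMeasure E) :=
  Measure.sum fun k : ℕ ↦ ENNReal.ofReal (Real.exp (-lam.real Set.univ) / k !) •
    (Measure.pi fun _ : Fin k ↦ lam).map config

lemma measure_lt_top (ξ : PointMeasure E) (B : Set E) : ξ.1 B < ∞ := by
  obtain ⟨ξ, m, z, rfl⟩ := ξ
  exact MeasureTheory.measure_lt_top _ B

lemma isProbabilityMeasure_PRM (lam : Measure E) [IsFiniteMeasure lam] :
    IsProbabilityMeasure (PRM lam) := by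
  constructor
  set r := (lam Set.univ).toNNReal with hr
  have hru : lam Set.univ = (r : ℝ≥0∞) := (ENNReal.coe_toNNReal (measure_ne_top _ _)).symm
  have hrr : lam.real Set.univ = (r : ℝ) := by simp [measureReal_def, hru]
  have h1 : ∀ k : ℕ, (ENNReal.ofReal (Real.exp (-lam.real Set.univ) / k !) •
      (Measure.pi fun _ : Fin k ↦ lam).map config : Measure (PointMeasure E)) Set.univ =
      ENNReal.ofReal (Real.exp (-r) * r ^ k / k !) := by
    intro k
    rw [Measure.smul_apply, Measure.map_apply (measurable_config k) MeasurableSet.univ,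
      Set.preimage_univ, Measure.pi_univ, hrr]
    simp only [hru, Finset.prod_const, Finset.card_univ, Fintype.card_fin, smul_eq_mul]
    rw [← ENNReal.ofReal_coe_nnreal, ← ENNReal.ofReal_pow (NNReal.coe_nonneg r),
      ← ENNReal.ofReal_mul (by positivity)]
    congr 1
    ring
  rw [PRM, Measure.sum_apply _ MeasurableSet.univ]
  simp_rw [h1]
  rw [← ENNReal.ofReal_tsum_of_nonneg (fun k ↦ by positivity)
    (hasSum_one_poissonMeasure r).summable, (hasSum_one_poissonMeasure r).tsum_eq,
    ENNReal.ofReal_one]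

open Complex in
/-- The joint characteristic function of the numbers of points in disjoint sets. -/
lemma integral_cexp_PRM (lam : Measure E) [IsFiniteMeasure lam] {m : ℕ} (B : Fin m → Set E)
    (hB : ∀ i, MeasurableSet (B i)) (hd : Pairwise (fun i j ↦ Disjoint (B i) (B j)))
    (t : Fin m → ℝ) :
    ∫ ξ : PointMeasure E, cexp (((∑ i, (ξ.1 (B i)).toReal * t i : ℝ) : ℂ) * I) ∂(PRM lam) =
      ∏ i, cexp (lam.real (B i) * (cexp (t i * I) - 1)) := by
  classical
  have := isProbabilityMeasure_PRM lam
  have hmeas : Measurable fun ξ : PointMeasure E ↦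
      cexp (((∑ i, (ξ.1 (B i)).toReal * t i : ℝ) : ℂ) * I) := by
    have : Measurable fun ξ : PointMeasure E ↦ (∑ i, (ξ.1 (B i)).toReal * t i : ℝ) :=
      Finset.measurable_sum _ fun i _ ↦ ((measurable_eval (hB i)).ennreal_toReal).mul_const _
    fun_prop
  have hint : Integrable (fun ξ : PointMeasure E ↦
      cexp (((∑ i, (ξ.1 (B i)).toReal * t i : ℝ) : ℂ) * I)) (PRM lam) :=
    Integrable.of_bound hmeas.aestronglyMeasurable 1
      (Filter.Eventually.of_forall fun ξ ↦ (norm_exp_ofReal_mul_I _).le)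
  set g : E → ℂ := fun z ↦ cexp (((∑ i, (B i).indicator (fun _ ↦ (1 : ℝ)) z * t i : ℝ) : ℂ) * I)
    with hg
  have hterm : ∀ k : ℕ, ∫ ξ : PointMeasure E, cexp (((∑ i, (ξ.1 (B i)).toReal * t i : ℝ) : ℂ) * I)
      ∂(ENNReal.ofReal (Real.exp (-lam.real Set.univ) / k !) •
      (Measure.pi fun _ : Fin k ↦ lam).map config) =
      cexp (-(lam.real Set.univ : ℂ)) * ((∫ z, g z ∂lam) ^ k / k !) := by
    intro k
    rw [integral_smul_measure, integral_map (measurable_config k).aemeasurable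
      hmeas.aestronglyMeasurable, ENNReal.toReal_ofReal (by positivity)]
    have : ∀ z : Fin k → E, cexp (((∑ i, ((config z).1 (B i)).toReal * t i : ℝ) : ℂ) * I) =
        ∏ j, g (z j) := by
      intro z
      rw [hg, ← Complex.exp_sum, ← Finset.sum_mul, ← ofReal_sum, Finset.sum_comm]
      congr 3
      refine Finset.sum_congr rfl fun i _ ↦ ?_
      rw [← Finset.sum_mul]
      congr 1
      simp only [config, Measure.finsetSum_apply]
      rw [ENNReal.toReal_sum (fun j _ ↦ (MeasureTheory.measure_lt_top (Measure.dirac (z j)) (B i)).ne)]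
      refine Finset.sum_congr rfl fun j _ ↦ ?_
      rw [Measure.dirac_apply' _ (hB i)]
      by_cases h : z j ∈ B i <;> simp [h]
    simp_rw [this]
    rw [integral_fintype_prod_eq_pow]
    simp only [Fintype.card_fin, real_smul]
    push_cast
    ring
  have hgi : ∫ z, g z ∂lam = lam.real Set.univ + ∑ i, lam.real (B i) * (cexp (t i * I) - 1) := by
    have hgz : ∀ z, g z = 1 + ∑ i, (B i).indicator (fun _ ↦ cexp (t i * I) - 1) z := by
      intro z
      by_cases h : ∃ i, z ∈ B i
      · obtain ⟨i, hi⟩ := h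
        have hne : ∀ j, j ≠ i → z ∉ B j := fun j hj hz ↦
          Set.disjoint_left.1 (hd hj) hz hi
        rw [Finset.sum_eq_single i (fun j _ hj ↦ by simp [hne j hj]) (by simp)]
        simp only [hg]
        rw [Finset.sum_eq_single i (fun j _ hj ↦ by simp [hne j hj]) (by simp)]
        simp [hi]
      · push Not at h
        simp [hg, h]
    simp_rw [hgz]
    rw [integral_add (integrable_const _) (integrable_finsetSum _ fun i _ ↦
      (integrable_const _).indicator (hB i)), integral_finsetSum _ fun i _ ↦
      (integrable_const _).indicator (hB i)]
    simp [integral_indicator_const, hB]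
  have hsum := hasSum_integral_measure (f := fun ξ : PointMeasure E ↦
      cexp (((∑ i, (ξ.1 (B i)).toReal * t i : ℝ) : ℂ) * I)) (μ := fun k : ℕ ↦
      ENNReal.ofReal (Real.exp (-lam.real Set.univ) / k !) •
      (Measure.pi fun _ : Fin k ↦ lam).map config) hint
  simp_rw [hterm] at hsum
  have hexp := (NormedSpace.expSeries_div_hasSum_exp (∫ z, g z ∂lam)).mul_left
    (cexp (-(lam.real Set.univ : ℂ)))
  rw [PRM, hsum.unique hexp, ← Complex.exp_eq_exp_ℂ, ← Complex.exp_add, hgi, ← Complex.exp_sum]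
  congr 1
  ring

open Complex in
theorem isPoissonLaw_PRM (lam : Measure E) [IsFiniteMeasure lam] :
    IsPoissonLaw lam (PRM lam) := by
  have hP := isProbabilityMeasure_PRM lam
  have hmr : ∀ B : Set E, MeasurableSet B →
      Measurable fun ξ : PointMeasure E ↦ (ξ.1 B).toReal := fun B hB ↦
    (measurable_eval hB).ennreal_toReal
  have hback : ∀ (B : Set E) (ξ : PointMeasure E), ENNReal.ofReal (ξ.1 B).toReal = ξ.1 B :=
    fun B ξ ↦ ENNReal.ofReal_toReal (measure_lt_top ξ B).ne
  have hchar : ∀ (B : Set E), MeasurableSet B → ∀ t : ℝ,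
      charFun ((PRM lam).map fun ξ ↦ (ξ.1 B).toReal) t =
        cexp (lam.real B * (cexp (t * I) - 1)) := by
    intro B hB t
    rw [charFun_apply, integral_map (hmr B hB).aemeasurable (by fun_prop)]
    have := integral_cexp_PRM lam (fun _ : Fin 1 ↦ B) (fun _ ↦ hB)
      (fun i j hij ↦ absurd (Subsingleton.elim i j) hij) (fun _ ↦ t)
    simp only [Finset.univ_unique, Finset.sum_singleton, Finset.prod_singleton] at this
    rw [← this]
    simp [mul_comm]
  refine ⟨hP, fun B hB ↦ ?_, fun m B hB hd ↦ ?_⟩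
  · have h1 : (PRM lam).map (fun ξ ↦ (ξ.1 B).toReal) =
        (poissonMeasure (lam B).toNNReal).map (Nat.cast : ℕ → ℝ) := by
      have := Measure.isProbabilityMeasure_map (μ := PRM lam) (hmr B hB).aemeasurable
      apply Measure.ext_of_charFun
      ext t
      rw [hchar B hB t, charFun_map_cast_poissonMeasure]
      rfl
    have h2 := congrArg (Measure.map ENNReal.ofReal) h1
    rw [Measure.map_map ENNReal.measurable_ofReal (hmr B hB),
      Measure.map_map ENNReal.measurable_ofReal .of_discrete] at h2
    have h3 : (ENNReal.ofReal ∘ fun ξ : PointMeasure E ↦ (ξ.1 B).toReal) = fun ξ ↦ ξ.1 B :=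
      funext fun ξ ↦ hback B ξ
    have h4 : (ENNReal.ofReal ∘ (Nat.cast : ℕ → ℝ)) = (Nat.cast : ℕ → ℝ≥0∞) :=
      funext fun k ↦ ENNReal.ofReal_natCast k
    rwa [h3, h4] at h2
  · have h1 : iIndepFun (fun i (ξ : PointMeasure E) ↦ (ξ.1 (B i)).toReal) (PRM lam) := by
      rw [iIndepFun_iff_charFun_pi (fun i ↦ (hmr _ (hB i)).aemeasurable)]
      intro t
      have hm : Measurable fun ξ : PointMeasure E ↦
          WithLp.toLp 2 (fun i ↦ (ξ.1 (B i)).toReal) := by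
        have : Measurable fun ξ : PointMeasure E ↦ fun i ↦ (ξ.1 (B i)).toReal :=
          measurable_pi_lambda _ fun i ↦ hmr _ (hB i)
        exact (WithLp.measurable_toLp 2 (Fin m → ℝ)).comp this
      simp_rw [fun i ↦ hchar (B i) (hB i)]
      rw [← integral_cexp_PRM lam B hB hd, charFun_apply,
        integral_map hm.aemeasurable (by fun_prop)]
      simp [PiLp.inner_apply, mul_comm]
    have h2 := h1.comp (fun _ ↦ ENNReal.ofReal) (fun _ ↦ ENNReal.measurable_ofReal)
    have h3 : (fun i ↦ ENNReal.ofReal ∘ fun ξ : PointMeasure E ↦ (ξ.1 (B i)).toReal) =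
        fun i (ξ : PointMeasure E) ↦ ξ.1 (B i) := by
      funext i ξ
      exact hback (B i) ξ
    rwa [h3] at h2

end General

/-- For measures of equal finite mass, functions of oscillation at most `1` have integrals that
differ at most by that mass. -/
lemma abs_integral_sub_le {X : Type*} [MeasurableSpace X] (μ ν : Measure X) [IsFiniteMeasure μ]
    [IsFiniteMeasure ν] (h : μ Set.univ = ν Set.univ) {f : X → ℝ} (hf : Measurable f)
    (hosc : ∀ x y, |f x - f y| ≤ 1) :
    |∫ x, f x ∂μ - ∫ x, f x ∂ν| ≤ μ.real Set.univ := by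
  rcases isEmpty_or_nonempty X with hX | hX
  · simp [Measure.eq_zero_of_isEmpty]
  have hbdd : BddBelow (Set.range f) := by
    obtain ⟨x₀⟩ := hX
    refine ⟨f x₀ - 1, ?_⟩
    rintro _ ⟨x, rfl⟩
    have := abs_le.1 (hosc x₀ x)
    linarith
  set a := ⨅ x, f x with ha
  have h0 : ∀ x, 0 ≤ f x - a := fun x ↦ sub_nonneg.2 (ciInf_le hbdd x)
  have h1 : ∀ x, f x - a ≤ 1 := fun x ↦ by
    have : f x - 1 ≤ a := le_ciInf fun y ↦ by
      have := abs_le.1 (hosc x y)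
      linarith
    linarith
  have hreal : μ.real Set.univ = ν.real Set.univ := by simp [measureReal_def, h]
  have key : ∀ (ρ : Measure X) [IsFiniteMeasure ρ],
      ∫ x, f x ∂ρ = ∫ x, (f x - a) ∂ρ + a * ρ.real Set.univ ∧
      0 ≤ ∫ x, (f x - a) ∂ρ ∧ ∫ x, (f x - a) ∂ρ ≤ ρ.real Set.univ := by
    intro ρ _
    have hi : Integrable (fun x ↦ f x - a) ρ :=
      Integrable.of_bound (hf.sub_const a).aestronglyMeasurable 1
        (Filter.Eventually.of_forall fun x ↦ by
          rw [Real.norm_eq_abs, abs_of_nonneg (h0 x)]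
          exact h1 x)
    refine ⟨?_, integral_nonneg h0, ?_⟩
    · have := integral_add hi (integrable_const a)
      simp only [sub_add_cancel, integral_const, smul_eq_mul] at this
      rw [this, mul_comm]
    · simpa using integral_mono hi (integrable_const (1 : ℝ)) h1
  obtain ⟨e1, p1, q1⟩ := key μ
  obtain ⟨e2, p2, q2⟩ := key ν
  rw [e1, e2, hreal, abs_le]
  rw [hreal] at q1
  constructor <;> linarith

section Distances

variable {E : Type*} [PseudoMetricSpace E] [MeasurableSpace E]

/-- The metric of `E`, bounded by `1`. -/
noncomputable def d0 (x y : E) : ℝ := min (dist x y) 1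

/-- The distance `d_1` between finite measures: `1` if the total masses differ, and otherwise the
supremum of `|∫ κ dρ - ∫ κ dσ|` over the functions `κ` with Lipschitz constant at most `1` with
respect to `d_0`, divided by the common total mass (and `0` if this mass is `0`). -/
noncomputable def d1 (ρ σ : Measure E) : ℝ :=
  if ρ Set.univ = σ Set.univ then
    (ρ.real Set.univ)⁻¹ *
      ⨆ κ : {κ : E → ℝ // ∀ x y, |κ x - κ y| ≤ d0 x y}, |∫ z, κ.1 z ∂ρ - ∫ z, κ.1 z ∂σ|
  else 1

/-- The distance `d_2` between probability measures on `M_p(E)`: the supremum of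
`|∫ h dμ - ∫ h dν|` over the functions `h` on `M_p(E)` with Lipschitz constant at most `1` with
respect to `d_1`. (When `E` is a separable metric space with its Borel `σ`-algebra, such functions
are measurable anyway; in general the integrals only make sense for measurable `h`.) -/
noncomputable def d2 (μ ν : Measure (PointMeasure E)) : ℝ :=
  ⨆ h : {h : PointMeasure E → ℝ // Measurable h ∧ ∀ ξ η, |h ξ - h η| ≤ d1 ξ.1 η.1},
    |∫ ξ, h.1 ξ ∂μ - ∫ ξ, h.1 ξ ∂ν|

lemma abs_integral_sub_le_of_lipschitz [OpensMeasurableSpace E] (ρ σ : Measure E)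
    [IsFiniteMeasure ρ] [IsFiniteMeasure σ] (h : ρ Set.univ = σ Set.univ) {κ : E → ℝ}
    (hκ : ∀ x y, |κ x - κ y| ≤ d0 x y) :
    |∫ z, κ z ∂ρ - ∫ z, κ z ∂σ| ≤ ρ.real Set.univ := by
  have hL : LipschitzWith 1 κ := LipschitzWith.of_dist_le_mul fun x y ↦ by
    rw [Real.dist_eq]
    simpa using (hκ x y).trans (min_le_left _ _)
  exact abs_integral_sub_le ρ σ h hL.continuous.measurable
    fun x y ↦ (hκ x y).trans (min_le_right _ _)

/-- The set of which `d1` takes the supremum is bounded. -/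
lemma bddAbove_d1 [OpensMeasurableSpace E] (ρ σ : Measure E)
    [IsFiniteMeasure ρ] [IsFiniteMeasure σ] (h : ρ Set.univ = σ Set.univ) :
    BddAbove (Set.range fun κ : {κ : E → ℝ // ∀ x y, |κ x - κ y| ≤ d0 x y} ↦
      |∫ z, κ.1 z ∂ρ - ∫ z, κ.1 z ∂σ|) := by
  refine ⟨ρ.real Set.univ, ?_⟩
  rintro _ ⟨κ, rfl⟩
  exact abs_integral_sub_le_of_lipschitz ρ σ h κ.2

lemma d1_le_one [OpensMeasurableSpace E] (ρ σ : Measure E)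
    [IsFiniteMeasure ρ] [IsFiniteMeasure σ] : d1 ρ σ ≤ 1 := by
  unfold d1
  split_ifs with h
  · refine (mul_le_mul_of_nonneg_left (Real.iSup_le (fun κ ↦
      abs_integral_sub_le_of_lipschitz ρ σ h κ.2) measureReal_nonneg)
      (inv_nonneg.2 measureReal_nonneg)).trans ?_
    exact inv_mul_le_one
  · exact le_rfl

/-- The set of which `d2` takes the supremum is bounded. -/
lemma bddAbove_d2 [OpensMeasurableSpace E] (μ ν : Measure (PointMeasure E))
    [IsProbabilityMeasure μ] [IsProbabilityMeasure ν] :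
    BddAbove (Set.range fun h : {h : PointMeasure E → ℝ //
        Measurable h ∧ ∀ ξ η, |h ξ - h η| ≤ d1 ξ.1 η.1} ↦
      |∫ ξ, h.1 ξ ∂μ - ∫ ξ, h.1 ξ ∂ν|) := by
  refine ⟨μ.real Set.univ, ?_⟩
  rintro _ ⟨h, rfl⟩
  refine abs_integral_sub_le μ ν (by simp) h.2.1 fun ξ η ↦ (h.2.2 ξ η).trans ?_
  have : IsFiniteMeasure ξ.1 := ⟨measure_lt_top ξ _⟩
  have : IsFiniteMeasure η.1 := ⟨measure_lt_top η _⟩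
  exact d1_le_one _ _

end Distances

end PointProcess

namespace MarshallOlkin

/-- The point probabilities of the Marshall-Olkin geometric distribution on `ℤ₊²` with marginal
failure probabilities `q₁`, `q₂` and joint failure probability `p₀₀`. -/
noncomputable def geometricPMF (q₁ q₂ p₀₀ : ℝ) (x : ℕ × ℕ) : ℝ :=
  if x.1 < x.2 then p₀₀ ^ x.1 * q₂ ^ (x.2 - x.1) * (1 - p₀₀ / q₂ - q₂ + p₀₀)
  else if x.1 = x.2 then p₀₀ ^ x.1 * (1 - q₁ - q₂ + p₀₀)
  else p₀₀ ^ x.2 * q₁ ^ (x.1 - x.2) * (1 - q₁ - p₀₀ / q₁ + p₀₀)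

/-- The Marshall-Olkin geometric distribution. -/
noncomputable def geometricLaw (q₁ q₂ p₀₀ : ℝ) : Measure (ℕ × ℕ) :=
  Measure.sum fun x ↦ ENNReal.ofReal (geometricPMF q₁ q₂ p₀₀ x) • Measure.dirac x

/-- The plane, with the Euclidean norm. -/
abbrev Plane : Type := EuclideanSpace ℝ (Fin 2)

/-- The normalisation `(k, l) ↦ (k log(1/p₀₀) - log n, l log(1/p₀₀) - log n)`. -/
noncomputable def normalise (n : ℕ) (p₀₀ : ℝ) (x : ℕ × ℕ) : Plane :=
  !₂[x.1 * Real.log (1 / p₀₀) - Real.log n, x.2 * Real.log (1 / p₀₀) - Real.log n]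

/-- The set `[u, ∞)²`. -/
def quadrant (u : ℝ) : Set Plane := {z | u ≤ z 0 ∧ u ≤ z 1}

/-- The marked point process `∑ i, I_{X*_i ∈ A} δ_{X*_i}` of the joint exceedances of `u`, where
`X*_i` are the normalised marks and `A = [u, ∞)²`; it is a random point measure on `A`. -/
noncomputable def exceedanceProcess {Ω : Type*} (n : ℕ) (p₀₀ u : ℝ) (X : Fin n → Ω → ℕ × ℕ)
    (ω : Ω) : PointProcess.PointMeasure (quadrant u) :=
  PointProcess.configIn (quadrant u) fun i ↦ normalise n p₀₀ (X i ω)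

/-- The off-diagonal part `λ*_{γ,δ}(s, t)` of the limiting intensity. -/
noncomputable def offDiagonalIntensity (γ δ : ℝ) (z : Plane) : ℝ :=
  if z 0 < z 1 then
    γ * (1 + δ) / (1 + γ + δ) ^ 2 *
      Real.exp (-(γ / (1 + γ + δ)) * z 0) * Real.exp (-((1 + δ) / (1 + γ + δ)) * z 1)
  else if z 1 < z 0 then
    δ * (1 + γ) / (1 + γ + δ) ^ 2 *
      Real.exp (-((1 + γ) / (1 + γ + δ)) * z 0) * Real.exp (-(δ / (1 + γ + δ)) * z 1)
  else 0

/-- The intensity on the diagonal `s = t`, parametrised by its projection to the `s`-axis. -/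
noncomputable def diagonalIntensity (γ δ s : ℝ) : ℝ :=
  1 / (1 + γ + δ) * Real.exp (-s)

/-- The measure on the plane with density `offDiagonalIntensity` with respect to two-dimensional
Lebesgue measure off the diagonal, and density `diagonalIntensity` with respect to
one-dimensional Lebesgue measure `ds` on the diagonal. -/
noncomputable def intensityMeasure (γ δ : ℝ) : Measure Plane :=
  (volume.withDensity fun z : Plane ↦ ENNReal.ofReal (offDiagonalIntensity γ δ z)) +
    (volume.withDensity fun s : ℝ ↦ ENNReal.ofReal (diagonalIntensity γ δ s)).map
      fun s ↦ (!₂[s, s] : Plane)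

/-- The restriction of `intensityMeasure γ δ` to `[u, ∞)²`, as a measure on `[u, ∞)²`. -/
noncomputable def limitMeanMeasure (γ δ u : ℝ) : Measure (quadrant u) :=
  (intensityMeasure γ δ).comap Subtype.val

end MarshallOlkin

/-!
The exceedances of `n` independent points in `A = [u, ∞)²` are a binomial number of independent
points of `A`, and the limiting Poisson process is a Poisson number of independent points of `A`, so
`d_2` splits into a comparison of the two numbers of points and a comparison of the two laws of a
point.

Up to its total mass `exp (-u)`, the limiting intensity is the law of `(u + S + Y⁻, u + S + Y⁺)`
with `S` standard exponential and `Y` an independent two-sided exponential variable with an atom at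
`0`. Rounding `S` and `Y` to suitable lattices turns this law into exactly the Marshall–Olkin
geometric law, and by lack of memory the latter, restricted to `{x | k ≤ x.1 ∧ k ≤ x.2}`, is
`p₀₀ ^ k` times its own translate. Hence a normalised geometric point in `A` is a limiting point
moved by at most `3 r + ε |Y|`, where `r = log (1 / p₀₀)`, `ε = x / (1 - x)` and
`x = (1 + γ + δ) p₁₁`; this bounds the second comparison. The number of points has law
`Bin(n, p₀₀ ^ k)` with `k = ⌈(u + log n) / r⌉`, which is within `p₀₀ ^ k ≤ exp (-u) / n` of
`Po(n * p₀₀ ^ k)`, whose mean lies between `p₀₀ * exp (-u)` and `exp (-u)`.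
-/

open scoped NNReal unitInterval

namespace PoissonApproximation

section BoundedOscillation

variable {X : Type*} [MeasurableSpace X]

lemma integrable_of_forall_abs_sub_le (μ : Measure X) [IsFiniteMeasure μ] {f : X → ℝ}
    (hf : Measurable f) {c : ℝ} (hosc : ∀ x y, |f x - f y| ≤ c) : Integrable f μ := by
  rcases isEmpty_or_nonempty X with _ | ⟨⟨x₀⟩⟩
  · simp [Measure.eq_zero_of_isEmpty μ]
  · refine .of_bound hf.aestronglyMeasurable (|f x₀| + c) (.of_forall fun x ↦ ?_)
    rw [Real.norm_eq_abs]
    linarith [hosc x x₀, abs_sub_abs_le_abs_sub (f x) (f x₀)]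

lemma integrable_of_forall_mem_Icc (μ : Measure X) [IsFiniteMeasure μ] {f : X → ℝ}
    (hf : Measurable f) {a b : ℝ} (hfab : ∀ x, f x ∈ Set.Icc a b) : Integrable f μ :=
  integrable_of_forall_abs_sub_le μ hf fun x y ↦ abs_sub_le_of_le_of_le
    (hfab x).1 (hfab x).2 (hfab y).1 (hfab y).2

/-- Replacing `f` by `f - inf f` and by `f ↦ -f` reduces a two-sided estimate for functions of
oscillation at most `1` to a one-sided estimate for functions with values in `[0, 1]`. -/
lemma abs_integral_sub_le_of_forall_mem_Icc {μ ν : Measure X} [IsProbabilityMeasure μ]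
    [IsProbabilityMeasure ν] {ε : ℝ}
    (hε : ∀ g : X → ℝ, Measurable g → (∀ x, g x ∈ Set.Icc 0 1) →
      ∫ x, g x ∂μ - ∫ x, g x ∂ν ≤ ε)
    {f : X → ℝ} (hf : Measurable f) (hosc : ∀ x y, |f x - f y| ≤ 1) :
    |∫ x, f x ∂μ - ∫ x, f x ∂ν| ≤ ε := by
  have : Nonempty X := nonempty_of_isProbabilityMeasure μ
  have one_sided {f : X → ℝ} (hf : Measurable f) (hosc : ∀ x y, |f x - f y| ≤ 1) :
      ∫ x, f x ∂μ - ∫ x, f x ∂ν ≤ ε := by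
    have hbdd : BddBelow (Set.range f) := by
      refine ⟨f (Classical.arbitrary X) - 1, ?_⟩
      rintro _ ⟨x, rfl⟩
      linarith [abs_le.1 (hosc (Classical.arbitrary X) x)]
    have hmem : ∀ x, f x - ⨅ y, f y ∈ Set.Icc 0 1 := fun x ↦ by
      have : f x - 1 ≤ ⨅ y, f y := le_ciInf fun y ↦ by linarith [abs_le.1 (hosc x y)]
      exact ⟨sub_nonneg.2 (ciInf_le hbdd x), by linarith⟩
    have hshift := hε _ (hf.sub_const _) hmem
    rw [integral_sub (integrable_of_forall_abs_sub_le μ hf hosc) (integrable_const _),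
      integral_sub (integrable_of_forall_abs_sub_le ν hf hosc) (integrable_const _)] at hshift
    simpa using hshift
  have hneg := one_sided hf.neg fun x y ↦ by
    rw [Pi.neg_apply, Pi.neg_apply, neg_sub_neg]; exact hosc y x
  simp only [Pi.neg_apply, integral_neg] at hneg
  exact abs_le.2 ⟨by linarith, one_sided hf hosc⟩

lemma setIntegral_sub_integral (μ : Measure X) [IsProbabilityMeasure μ] {s : Set X}
    (hs : MeasurableSet s) {f : X → ℝ} (hf : Integrable f μ) :
    ∫ x in s, (f x - ∫ y, f y ∂μ) ∂μ =
      (∫ x in s, f x ∂μ) * μ.real sᶜ - μ.real s * ∫ x in sᶜ, f x ∂μ := by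
  rw [integral_sub hf.integrableOn (integrable_const _), setIntegral_const, smul_eq_mul,
    ← integral_add_compl hs hf, probReal_compl_eq_one_sub hs]
  ring

end BoundedOscillation

section SteinChen

variable {r : ℝ≥0} {H : ℕ → ℝ}

lemma succ_mul_poissonMeasure_real_singleton_succ (r : ℝ≥0) (k : ℕ) :
    (k + 1) * Po(r).real {k + 1} = r * Po(r).real {k} := by
  rw [poissonMeasure_real_singleton, poissonMeasure_real_singleton, Nat.factorial_succ]
  push_cast
  field_simp
  ring

lemma lintegral_natCast_mul_poissonMeasure (r : ℝ≥0) (g : ℕ → ℝ≥0∞) :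
    ∫⁻ k, k * g k ∂Po(r) = r * ∫⁻ k, g (k + 1) ∂Po(r) := by
  have hrec (k : ℕ) : ((k + 1 : ℕ) : ℝ≥0∞) * Po(r) {k + 1} = r * Po(r) {k} := by
    rw [← ENNReal.toReal_eq_toReal_iff' (by finiteness) (by finiteness)]
    simpa using! succ_mul_poissonMeasure_real_singleton_succ r k
  rw [lintegral_countable', lintegral_countable', tsum_eq_zero_add' ENNReal.summable,
    ← ENNReal.tsum_mul_left]
  simp_rw [mul_right_comm _ (g _), hrec]
  simp [mul_comm, mul_left_comm]

lemma setLIntegral_natCast_poissonMeasure (r : ℝ≥0) (s : Set ℕ) :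
    ∫⁻ k in s, k ∂Po(r) = r * Po(r) ((· + 1) ⁻¹' s) := by
  calc ∫⁻ k in s, k ∂Po(r) = ∫⁻ k, k * s.indicator 1 k ∂Po(r) := by
        rw [← lintegral_indicator (.of_discrete)]
        exact lintegral_congr fun k ↦ by by_cases hk : k ∈ s <;> simp [hk]
    _ = r * ∫⁻ k, ((· + 1) ⁻¹' s).indicator 1 k ∂Po(r) :=
        lintegral_natCast_mul_poissonMeasure r _
    _ = r * Po(r) ((· + 1) ⁻¹' s) := by rw [lintegral_indicator_one (.of_discrete)]

lemma mul_poissonMeasure_real_Iio_le (r : ℝ≥0) (k : ℕ) :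
    r * Po(r).real (Set.Iio k) ≤ k * Po(r).real (Set.Iio (k + 1)) := by
  have h : r * Po(r) (Set.Iio k) ≤ k * Po(r) (Set.Iio (k + 1)) := by
    calc r * Po(r) (Set.Iio k) = ∫⁻ j in Set.Iio (k + 1), j ∂Po(r) := by
          rw [setLIntegral_natCast_poissonMeasure]; congr 2; ext; simp
      _ ≤ ∫⁻ _ in Set.Iio (k + 1), k ∂Po(r) := setLIntegral_mono' (by measurability)
          fun j hj ↦ by exact_mod_cast Nat.le_of_lt_succ hj
      _ = k * Po(r) (Set.Iio (k + 1)) := by simp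
  simpa [measureReal_def] using! ENNReal.toReal_mono (by finiteness) h

lemma mul_poissonMeasure_real_Ici_succ_le (r : ℝ≥0) (k : ℕ) :
    k * Po(r).real (Set.Ici (k + 1)) ≤ r * Po(r).real (Set.Ici k) := by
  have h : k * Po(r) (Set.Ici (k + 1)) ≤ r * Po(r) (Set.Ici k) := by
    calc k * Po(r) (Set.Ici (k + 1)) = ∫⁻ _ in Set.Ici (k + 1), k ∂Po(r) := by simp
      _ ≤ ∫⁻ j in Set.Ici (k + 1), j ∂Po(r) := setLIntegral_mono' (by measurability)
          fun j hj ↦ by exact_mod_cast (Nat.le_succ k).trans hj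
      _ = r * Po(r) (Set.Ici k) := by
          rw [setLIntegral_natCast_poissonMeasure]; congr 2; ext; simp
  simpa [measureReal_def] using! ENNReal.toReal_mono (by finiteness) h

/-- The solution `g` of the Stein equation `r g(k + 1) - k g(k) = H(k) - E H(N)`, where `N` is
Poisson distributed with mean `r`; its value at `0` is the junk value `0`. -/
noncomputable def steinSolution (r : ℝ≥0) (H : ℕ → ℝ) (k : ℕ) : ℝ :=
  (∫ j in Set.Iio k, (H j - ∫ i, H i ∂Po(r)) ∂Po(r)) / (k * Po(r).real {k})

lemma setIntegral_Iio_succ (μ : Measure ℕ) {f : ℕ → ℝ} (hf : Integrable f μ) (k : ℕ) :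
    ∫ j in Set.Iio (k + 1), f j ∂μ = ∫ j in Set.Iio k, f j ∂μ + μ.real {k} * f k := by
  rw [← Order.succ_eq_add_one, Order.Iio_succ_eq_insert, Set.insert_eq, Set.union_comm,
    setIntegral_union (by simp) (by simp) hf.integrableOn hf.integrableOn, integral_singleton,
    smul_eq_mul]

lemma setIntegral_Ici_eq_add_succ (μ : Measure ℕ) {f : ℕ → ℝ} (hf : Integrable f μ) (k : ℕ) :
    ∫ j in Set.Ici k, f j ∂μ = ∫ j in Set.Ici (k + 1), f j ∂μ + μ.real {k} * f k := by
  rw [← Order.succ_eq_add_one, Order.Ici_succ, ← Set.Ioi_insert, Set.insert_eq, Set.union_comm,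
    setIntegral_union (by simp) (by simp) hf.integrableOn hf.integrableOn, integral_singleton,
    smul_eq_mul]

lemma steinSolution_succ (r : ℝ≥0) (H : ℕ → ℝ) (k : ℕ) :
    steinSolution r H (k + 1) =
      (∫ j in Set.Iio (k + 1), (H j - ∫ i, H i ∂Po(r)) ∂Po(r)) / (r * Po(r).real {k}) := by
  rw [steinSolution, Nat.cast_succ, succ_mul_poissonMeasure_real_singleton_succ]

lemma steinSolution_eq (hr : 0 < r) (hH : Integrable H Po(r)) (k : ℕ) :
    r * steinSolution r H (k + 1) - k * steinSolution r H k = H k - ∫ i, H i ∂Po(r) := by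
  have hw := (poissonMeasure_real_singleton_pos k hr).ne'
  have hk : k * steinSolution r H k =
      (∫ j in Set.Iio k, (H j - ∫ i, H i ∂Po(r)) ∂Po(r)) / Po(r).real {k} := by
    rcases eq_or_ne k 0 with rfl | hk
    · simp
    · unfold steinSolution
      field_simp
  rw [hk, steinSolution_succ, setIntegral_Iio_succ _ (f := fun j ↦ H j - ∫ i, H i ∂Po(r))
    (hH.sub (integrable_const _))]
  have : (r : ℝ) ≠ 0 := by exact_mod_cast hr.ne'
  field_simp
  ring

lemma steinSolution_succ_sub_le (hr : 0 < r) (hH : ∀ k, H k ∈ Set.Icc 0 1) {k : ℕ} (hk : 0 < k) :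
    steinSolution r H (k + 1) - steinSolution r H k ≤ 1 / r := by
  have hHint : Integrable H Po(r) := integrable_of_forall_mem_Icc _ .of_discrete hH
  have hr' : (0 : ℝ) < r := hr
  have hw := poissonMeasure_real_singleton_pos k hr
  rw [steinSolution_succ, steinSolution, setIntegral_sub_integral _ measurableSet_Iio hHint,
    setIntegral_sub_integral _ measurableSet_Iio hHint, Set.compl_Iio, Set.compl_Iio,
    setIntegral_Iio_succ _ hHint, setIntegral_Ici_eq_add_succ _ hHint k]
  have hS : 0 ≤ ∫ j in Set.Iio k, H j ∂Po(r) := integral_nonneg fun j ↦ (hH j).1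
  have hT' : 0 ≤ ∫ j in Set.Ici (k + 1), H j ∂Po(r) := integral_nonneg fun j ↦ (hH j).1
  have hA := mul_poissonMeasure_real_Iio_le r k
  have hR := mul_poissonMeasure_real_Ici_succ_le r k
  have hAR : Po(r).real (Set.Iio (k + 1)) + Po(r).real (Set.Ici (k + 1)) = 1 := by
    rw [← Set.compl_Iio, probReal_add_probReal_compl measurableSet_Iio]
  have hA0 : 0 ≤ Po(r).real (Set.Iio k) := measureReal_nonneg
  have hR'0 : 0 ≤ Po(r).real (Set.Ici (k + 1)) := measureReal_nonneg
  obtain ⟨hH0, hH1⟩ := hH k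
  have hk' : (0 : ℝ) < k := by exact_mod_cast hk
  generalize ∫ j in Set.Iio k, H j ∂Po(r) = S at *
  generalize ∫ j in Set.Ici (k + 1), H j ∂Po(r) = T at *
  generalize Po(r).real (Set.Iio (k + 1)) = A' at *
  generalize Po(r).real (Set.Ici (k + 1)) = R' at *
  generalize Po(r).real (Set.Iio k) = A at *
  generalize Po(r).real (Set.Ici k) = R at *
  generalize Po(r).real {k} = w at *
  -- The terms that do not involve `H k` are nonpositive by the two tail inequalities.
  have hkey : k * ((S + w * H k) * R' - A' * T) - r * (S * R - A * (T + w * H k)) ≤ k * w := by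
    calc _ = S * (k * R' - r * R) + T * (r * A - k * A') + w * H k * (k * R' + r * A) := by ring
      _ ≤ 0 + 0 + w * 1 * (k * R' + k * A') := by
        have := mul_nonpos_of_nonneg_of_nonpos hS (sub_nonpos.2 hR)
        have := mul_nonpos_of_nonneg_of_nonpos hT' (sub_nonpos.2 hA)
        gcongr
      _ = k * w := by linear_combination k * w * hAR
  rw [div_sub_div _ _ (by positivity) (by positivity), div_le_div_iff₀ (by positivity) hr']
  nlinarith [mul_le_mul_of_nonneg_left hkey (by positivity : 0 ≤ r * w)]

end SteinChen

section Binomial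

lemma binomial_succ (n : ℕ) (p : I) :
    Bin(n + 1, p) = ENNReal.ofReal (1 - p) • Bin(n, p) +
      ENNReal.ofReal p • Bin(n, p).map Nat.succ := by
  have hp := p.2.1
  have hp' : (0 : ℝ) ≤ 1 - p := sub_nonneg.2 p.2.2
  have : IsFiniteMeasure (ENNReal.ofReal (1 - p) • Bin(n, p)) := Measure.smul_finite _ (by simp)
  have : IsFiniteMeasure (ENNReal.ofReal p • Bin(n, p).map Nat.succ) :=
    Measure.smul_finite _ (by simp)
  refine Measure.ext_of_measureReal_singleton fun k ↦ ?_
  rw [measureReal_add_apply, measureReal_ennreal_smul_apply, measureReal_ennreal_smul_apply,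
    map_measureReal_apply .of_discrete .of_discrete, ENNReal.toReal_ofReal hp',
    ENNReal.toReal_ofReal hp]
  cases k with
  | zero => simp [binomial_real_singleton, Set.preimage, pow_succ']
  | succ k =>
    have hpre : Nat.succ ⁻¹' {k + 1} = {k} := by ext; simp
    rw [hpre, binomial_real_singleton, binomial_real_singleton, binomial_real_singleton,
      Nat.choose_succ_succ', Nat.add_sub_add_right, pow_succ']
    rcases lt_or_ge k n with hk | hk
    · rw [show n - k = n - (k + 1) + 1 by lia]
      push_cast
      ring
    · rw [Nat.choose_eq_zero_of_lt (Nat.lt_succ_of_le hk)]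
      push_cast
      ring

lemma integral_binomial_succ (n : ℕ) (p : I) (f : ℕ → ℝ) :
    ∫ k, f k ∂Bin(n + 1, p) =
      (1 - p) * ∫ k, f k ∂Bin(n, p) + p * ∫ k, f (k + 1) ∂Bin(n, p) := by
  rw [binomial_succ, integral_add_measure (integrable_binomial f |>.smul_measure (by simp))
    (((integrable_map_measure .of_discrete .of_discrete).2
      (integrable_binomial _)).smul_measure (by simp)), integral_smul_measure,
    integral_smul_measure, integral_map .of_discrete .of_discrete,
    ENNReal.toReal_ofReal (sub_nonneg.2 p.2.2), ENNReal.toReal_ofReal p.2.1, smul_eq_mul,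
    smul_eq_mul]

lemma integral_natCast_mul_binomial_succ (n : ℕ) (p : I) (g : ℕ → ℝ) :
    ∫ k, k * g k ∂Bin(n + 1, p) = (n + 1) * p * ∫ k, g (k + 1) ∂Bin(n, p) := by
  simp_rw [integral_binomial, ← Nat.range_succ_eq_Iic, smul_eq_mul]
  rw [Finset.sum_range_succ', Finset.mul_sum]
  simp only [Nat.cast_zero, zero_mul, mul_zero, add_zero, Nat.add_sub_add_right]
  refine Finset.sum_congr rfl fun k _ ↦ ?_
  have h : ((n + 1 : ℕ) : ℝ) * n.choose k = (n + 1).choose (k + 1) * (k + 1 : ℕ) := by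
    exact_mod_cast Nat.add_one_mul_choose_eq n k
  push_cast at h ⊢
  linear_combination -(p : ℝ) ^ (k + 1) * (1 - p) ^ (n - k) * g (k + 1) * h

end Binomial

section BarbourHall

lemma binomial_eq_poissonMeasure_of_mul_eq_zero {n : ℕ} {p : I}
    (h : n * unitInterval.toNNReal p = 0) : Bin(n, p) = Po(n * unitInterval.toNNReal p) := by
  refine Measure.ext_of_measureReal_singleton fun k ↦ ?_
  rw [h, binomial_real_singleton, poissonMeasure_real_singleton]
  rcases mul_eq_zero.1 h with hn | hp
  · obtain rfl : n = 0 := by exact_mod_cast hn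
    cases k <;> simp
  · have hp : (p : ℝ) = 0 := by simpa using congrArg NNReal.toReal hp
    cases k <;> simp [hp]

theorem abs_integral_binomial_sub_integral_poissonMeasure_le (n : ℕ) (p : I) {H : ℕ → ℝ}
    (hosc : ∀ i j, |H i - H j| ≤ 1) :
    |∫ k, H k ∂Bin(n, p) - ∫ k, H k ∂Po(n * unitInterval.toNNReal p)| ≤ p := by
  rcases eq_zero_or_pos (n * unitInterval.toNNReal p) with hr | hr
  · rw [binomial_eq_poissonMeasure_of_mul_eq_zero hr, sub_self, abs_zero]
    exact p.2.1
  refine abs_integral_sub_le_of_forall_mem_Icc (fun G hG hG01 ↦ ?_) .of_discrete hosc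
  obtain ⟨m, rfl⟩ : ∃ m, n = m + 1 := Nat.exists_eq_succ_of_ne_zero (by rintro rfl; simp at hr)
  set r := (m + 1 : ℕ) * unitInterval.toNNReal p
  have hrp : (r : ℝ) = (m + 1) * p := by simp [r]
  set g := steinSolution r G
  have hint {f : ℕ → ℝ} : Integrable f Bin(m, p) := integrable_binomial f
  calc ∫ k, G k ∂Bin(m + 1, p) - ∫ k, G k ∂Po(r)
      = ∫ k, (r * g (k + 1) - k * g k) ∂Bin(m + 1, p) := by
        simp_rw [g, steinSolution_eq hr (integrable_of_forall_mem_Icc _ hG hG01)]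
        rw [integral_sub (integrable_binomial _) (integrable_const _)]
        simp
    _ = r * p * ∫ k, (g (k + 2) - g (k + 1)) ∂Bin(m, p) := by
        rw [integral_sub (integrable_binomial _) (integrable_binomial _), integral_const_mul,
          integral_natCast_mul_binomial_succ, integral_binomial_succ, integral_sub hint hint, ← hrp]
        ring
    _ ≤ r * p * ∫ _, (1 / r : ℝ) ∂Bin(m, p) := by
        have := p.2.1
        gcongr
        · exact hint
        · exact integrable_const _
        · exact fun k ↦ steinSolution_succ_sub_le hr hG01 k.zero_lt_succ
    _ = p := by
        have : (r : ℝ) ≠ 0 := by exact_mod_cast hr.ne'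
        simp
        field_simp

end BarbourHall

section PoissonComparison

lemma abs_integral_le_mul_measureReal {X : Type*} [MeasurableSpace X] {μ : Measure X}
    [IsFiniteMeasure μ] {f : X → ℝ} {c : ℝ} {s : Set X} (hfs : ∀ x ∉ s, f x = 0)
    (hf : ∀ x, |f x| ≤ c) : |∫ x, f x ∂μ| ≤ c * μ.real s := by
  rw [← setIntegral_eq_integral_of_forall_compl_eq_zero hfs]
  exact norm_setIntegral_le_of_norm_le_const (f := f) (measure_lt_top _ _) fun x _ ↦ hf x

lemma poissonMeasure_real_compl_zero_le (r : ℝ≥0) : Po(r).real {0}ᶜ ≤ min r 1 := by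
  refine le_min ?_ measureReal_le_one
  rw [probReal_compl_eq_one_sub .of_discrete, poissonMeasure_real_singleton]
  simp only [pow_zero, mul_one, Nat.factorial_zero, Nat.cast_one, div_one]
  rw [sub_le_comm]
  exact Real.one_sub_le_exp_neg r

/-- If `M` and `N` are independent, then `H(M)` and `H(M + N)` differ only if `N ≠ 0`. -/
lemma abs_integral_sub_integral_conv_le (μ ν : Measure ℕ) [IsProbabilityMeasure μ]
    [IsProbabilityMeasure ν] {H : ℕ → ℝ} (hosc : ∀ i j, |H i - H j| ≤ 1) :
    |∫ k, H k ∂μ - ∫ k, H k ∂(μ ∗ ν)| ≤ ν.real {0}ᶜ := by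
  have hint {X : Type} [MeasurableSpace X] (κ : Measure X) [IsFiniteMeasure κ] {f : X → ℕ}
      (hf : Measurable f) : Integrable (fun x ↦ H (f x)) κ :=
    integrable_of_forall_abs_sub_le κ (Measurable.of_discrete.comp hf) fun _ _ ↦ hosc _ _
  have hcoupling : ∫ k, H k ∂μ - ∫ k, H k ∂(μ ∗ ν) =
      ∫ z, (H z.1 - H (z.1 + z.2)) ∂(μ.prod ν) := by
    rw [Measure.conv, integral_map (by fun_prop) .of_discrete,
      integral_sub (hint _ measurable_fst) (hint _ (by fun_prop)), integral_fun_fst]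
    simp
  have hsnd : (μ.prod ν).real (Prod.snd ⁻¹' {0}ᶜ) = ν.real {0}ᶜ :=
    measurePreserving_snd.measureReal_preimage MeasurableSet.of_discrete.nullMeasurableSet
  rw [hcoupling, ← hsnd, ← one_mul ((μ.prod ν).real _)]
  exact abs_integral_le_mul_measureReal (fun z hz ↦ by simp_all) fun z ↦ hosc _ _

theorem abs_integral_poissonMeasure_sub_le {a b : ℝ≥0} (hab : a ≤ b) {H : ℕ → ℝ}
    (hosc : ∀ i j, |H i - H j| ≤ 1) : |∫ k, H k ∂Po(a) - ∫ k, H k ∂Po(b)| ≤ b - a := by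
  obtain ⟨r, rfl⟩ := exists_add_of_le hab
  rw [← poissonMeasure_conv_poissonMeasure, NNReal.coe_add, add_sub_cancel_left]
  exact (abs_integral_sub_integral_conv_le _ _ hosc).trans
    ((poissonMeasure_real_compl_zero_le r).trans (min_le_left _ _))

/-- The total variation distance is bounded in terms of the Hellinger affinity `ρ`, by the
Cauchy–Schwarz inequality for `|v - w| = |√v - √w| (√v + √w)`. -/
lemma tsum_sub_mul_le_sqrt_one_sub_sq {ι : Type*} {v w g : ι → ℝ} {ρ : ℝ} (hv₀ : ∀ i, 0 ≤ v i)
    (hw₀ : ∀ i, 0 ≤ w i) (hv : HasSum v 1) (hw : HasSum w 1)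
    (hρ : HasSum (fun i ↦ √(v i) * √(w i)) ρ) (hg : ∀ i, |g i| ≤ 1 / 2) :
    ∑' i, (v i - w i) * g i ≤ √(1 - ρ ^ 2) := by
  have hsub : HasSum (fun i ↦ |√(v i) - √(w i)| ^ (2 : ℝ)) (2 * (1 - ρ)) := by
    rw [show 2 * (1 - ρ) = 1 + 1 - 2 * ρ by ring]
    refine ((hv.add hw).sub (hρ.mul_left 2)).congr_fun fun i ↦ ?_
    rw [Real.rpow_two, sq_abs, sub_sq, Real.sq_sqrt (hv₀ i), Real.sq_sqrt (hw₀ i)]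
    ring
  have hadd : HasSum (fun i ↦ (√(v i) + √(w i)) ^ (2 : ℝ)) (2 * (1 + ρ)) := by
    rw [show 2 * (1 + ρ) = 1 + 1 + 2 * ρ by ring]
    refine ((hv.add hw).add (hρ.mul_left 2)).congr_fun fun i ↦ ?_
    rw [Real.rpow_two, add_sq, Real.sq_sqrt (hv₀ i), Real.sq_sqrt (hw₀ i)]
    ring
  obtain ⟨hsum, hle⟩ := Real.summable_and_inner_le_Lp_mul_Lq_tsum_of_nonneg .two_two
    (fun i ↦ abs_nonneg _) (fun i ↦ by positivity) hsub.summable hadd.summable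
  have hterm (i : ι) : ‖(v i - w i) * g i‖ ≤
      1 / 2 * (|√(v i) - √(w i)| * (√(v i) + √(w i))) := by
    have hfac : |v i - w i| = |√(v i) - √(w i)| * (√(v i) + √(w i)) := by
      rw [← abs_of_nonneg (by positivity : 0 ≤ √(v i) + √(w i)), ← abs_mul,
        mul_comm (√(v i) - √(w i)), ← sq_sub_sq, Real.sq_sqrt (hv₀ i), Real.sq_sqrt (hw₀ i)]
    rw [Real.norm_eq_abs, abs_mul, hfac, mul_comm (1 / 2)]
    gcongr
    exact hg i
  have hbound := tsum_of_norm_bounded (hsum.hasSum.mul_left (1 / 2)) hterm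
  calc ∑' i, (v i - w i) * g i ≤ 1 / 2 * ∑' i, |√(v i) - √(w i)| * (√(v i) + √(w i)) :=
        (le_abs_self _).trans hbound
    _ ≤ 1 / 2 * (√(2 * (1 - ρ)) * √(2 * (1 + ρ))) := by
        rw [Real.sqrt_eq_rpow, Real.sqrt_eq_rpow, ← hsub.tsum_eq, ← hadd.tsum_eq]
        gcongr
    _ = √(1 - ρ ^ 2) := by
        have hρ' : 0 ≤ 2 * (1 - ρ) := hsub.nonneg fun i ↦ by positivity
        rw [← Real.sqrt_mul hρ', show 2 * (1 - ρ) * (2 * (1 + ρ)) = 2 ^ 2 * (1 - ρ ^ 2) by ring,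
          Real.sqrt_mul (by positivity), Real.sqrt_sq zero_le_two]
        ring

lemma hasSum_sqrt_mul_sqrt_poissonMeasure (a b : ℝ≥0) :
    HasSum (fun k ↦ √(Po(a).real {k}) * √(Po(b).real {k})) (Real.exp (-(√b - √a) ^ 2 / 2)) := by
  have hsqrt (r : ℝ≥0) (k : ℕ) :
      √(Po(r).real {k}) = Real.exp (-r / 2) * √r ^ k / √(k ! : ℝ) := by
    have hpow : √((r : ℝ) ^ k) = √r ^ k := by
      rw [Real.sqrt_eq_iff_mul_self_eq (by positivity) (by positivity), ← mul_pow,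
        Real.mul_self_sqrt r.coe_nonneg]
    rw [poissonMeasure_real_singleton, Real.sqrt_div (by positivity), Real.sqrt_mul (by positivity),
      Real.exp_half, hpow]
  have hexp : Real.exp (-(√b - √a) ^ 2 / 2) =
      Real.exp (-a / 2) * Real.exp (-b / 2) * Real.exp (√a * √b) := by
    rw [← Real.exp_add, ← Real.exp_add, sub_sq, Real.sq_sqrt a.coe_nonneg,
      Real.sq_sqrt b.coe_nonneg]
    ring_nf
  have hseries := NormedSpace.expSeries_div_hasSum_exp (𝔸 := ℝ) (√a * √b)
  rw [← Real.exp_eq_exp_ℝ] at hseries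
  rw [hexp]
  refine (hseries.mul_left _).congr_fun fun k ↦ ?_
  rw [hsqrt, hsqrt, div_mul_div_comm, Real.mul_self_sqrt (by positivity)]
  ring

theorem abs_integral_poissonMeasure_sub_le_sqrt {a b : ℝ≥0} (hab : a ≤ b) {H : ℕ → ℝ}
    (hosc : ∀ i j, |H i - H j| ≤ 1) : |∫ k, H k ∂Po(a) - ∫ k, H k ∂Po(b)| ≤ √b - √a := by
  have hx : 0 ≤ √(b : ℝ) - √a := sub_nonneg.2 (Real.sqrt_le_sqrt hab)
  refine abs_integral_sub_le_of_forall_mem_Icc (fun G hG hG01 ↦ ?_) .of_discrete hosc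
  have hsum (r : ℝ≥0) :
      HasSum (fun k ↦ Po(r).real {k} * (G k - 1 / 2)) (∫ k, G k ∂Po(r) - 1 / 2) := by
    have hint : Integrable G Po(r) := integrable_of_forall_mem_Icc _ hG hG01
    have h := hasSum_integral_poissonMeasure (hint.sub (integrable_const (1 / 2)))
    simpa only [Pi.sub_apply, integral_sub hint (integrable_const _), integral_const,
      probReal_univ, smul_eq_mul, one_mul, ← poissonMeasure_real_singleton] using h
  have hone (r : ℝ≥0) : HasSum (fun k ↦ Po(r).real {k}) 1 := by
    simpa [poissonMeasure_real_singleton] using hasSum_one_poissonMeasure r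
  calc ∫ k, G k ∂Po(a) - ∫ k, G k ∂Po(b)
      = ∑' k, (Po(a).real {k} - Po(b).real {k}) * (G k - 1 / 2) := by
        simp_rw [sub_mul (Po(a).real _)]
        rw [((hsum a).sub (hsum b)).tsum_eq, sub_sub_sub_cancel_right]
    _ ≤ √(1 - Real.exp (-(√b - √a) ^ 2 / 2) ^ 2) :=
        tsum_sub_mul_le_sqrt_one_sub_sq (fun _ ↦ measureReal_nonneg) (fun _ ↦ measureReal_nonneg)
          (hone a) (hone b) (hasSum_sqrt_mul_sqrt_poissonMeasure a b) fun k ↦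
          abs_le.2 ⟨by linarith [(hG01 k).1], by linarith [(hG01 k).2]⟩
    _ ≤ √((√b - √a) ^ 2) := by
        gcongr
        have hexp : Real.exp (-(√b - √a) ^ 2 / 2) ^ 2 = Real.exp (-(√b - √a) ^ 2) := by
          rw [← Real.exp_nat_mul]
          congr 1
          push_cast
          ring
        rw [hexp, sub_le_comm]
        exact Real.one_sub_le_exp_neg _
    _ = √b - √a := Real.sqrt_sq hx

lemma abs_integral_poissonMeasure_sub_le_min_mul (b : ℝ≥0) {H K : ℕ → ℝ} {W : ℝ}
    (hH : ∀ i j, |H i - H j| ≤ 1) (hK : ∀ i j, |K i - K j| ≤ 1) (h₀ : H 0 = K 0)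
    (hW : ∀ k, |H k - K k| ≤ W) : |∫ k, H k ∂Po(b) - ∫ k, K k ∂Po(b)| ≤ min (b : ℝ) 1 * W := by
  have hint {F : ℕ → ℝ} (hF : ∀ i j, |F i - F j| ≤ 1) : Integrable F Po(b) :=
    integrable_of_forall_abs_sub_le _ .of_discrete hF
  rw [← integral_sub (hint hH) (hint hK), mul_comm]
  have hW₀ : 0 ≤ W := (abs_nonneg _).trans (hW 0)
  exact (abs_integral_le_mul_measureReal (s := {0}ᶜ) (fun k hk ↦ by simp_all) hW).trans
    (mul_le_mul_of_nonneg_left (poissonMeasure_real_compl_zero_le b) hW₀)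

end PoissonComparison

end PoissonApproximation

namespace PointProcess

open PoissonApproximation

section MixedBinomial

variable {E : Type*} [MeasurableSpace E]

/-- The law of the mixed binomial process `∑ i < κ, δ_{z i}`, where `κ` has law `N` and the points
`z i` are independent of `κ` and of each other, with law `ν`. -/
noncomputable def mixedBinomialLaw (N : Measure ℕ) (ν : Measure E) : Measure (PointMeasure E) :=
  N.bind fun k ↦ (Measure.pi fun _ : Fin k ↦ ν).map config

/-- The point measure `δ_a + ξ`, used to build point processes point by point. -/
noncomputable def addPoint (a : E) (ξ : PointMeasure E) : PointMeasure E :=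
  ⟨Measure.dirac a + ξ.1, (isPointMeasure_dirac a).add ξ.2⟩

lemma measurable_addPoint (a : E) : Measurable (addPoint a) := by
  refine Measurable.subtype_mk (Measure.measurable_of_measurable_coe _ fun s hs ↦ ?_)
  simp only [Measure.add_apply]
  exact measurable_const.add (measurable_eval hs)

lemma config_cons {n : ℕ} (a : E) (z : Fin n → E) :
    config (Fin.cons a z : Fin (n + 1) → E) = addPoint a (config z) :=
  Subtype.ext <| by simp [config, addPoint, Fin.sum_univ_succ]

lemma configIn_cons_of_mem {n : ℕ} {A : Set E} {a : E} (ha : a ∈ A) (x : Fin n → E) :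
    configIn A (Fin.cons a x : Fin (n + 1) → E) = addPoint ⟨a, ha⟩ (configIn A x) :=
  Subtype.ext <| (Fin.sum_univ_succ _).trans <| congrArg (· + (configIn A x).1) (dif_pos ha)

lemma configIn_cons_of_notMem {n : ℕ} {A : Set E} {a : E} (ha : a ∉ A) (x : Fin n → E) :
    configIn A (Fin.cons a x : Fin (n + 1) → E) = configIn A x :=
  Subtype.ext <| (Fin.sum_univ_succ _).trans <|
    (congrArg (· + (configIn A x).1) (dif_neg ha)).trans (zero_add _)

lemma measurable_configIn {A : Set E} (hA : MeasurableSet A) (n : ℕ) :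
    Measurable (configIn A : (Fin n → E) → PointMeasure A) := by
  classical
  refine Measurable.subtype_mk (Measure.measurable_of_measurable_coe _ fun s hs ↦ ?_)
  simp only [Measure.finsetSum_apply]
  refine Finset.measurable_sum _ fun i _ ↦ ?_
  have hind : (fun x : Fin n → E ↦
      (if h : x i ∈ A then Measure.dirac (⟨x i, h⟩ : A) else 0) s) =
      fun x ↦ (Subtype.val '' s).indicator (fun _ ↦ (1 : ℝ≥0∞)) (x i) := by
    funext x
    by_cases h : x i ∈ A
    · by_cases h' : (⟨x i, h⟩ : A) ∈ s <;> simp [h, hs, h']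
    · simp [h]
  rw [hind]
  exact (measurable_const.indicator (hA.subtype_image hs)).comp (measurable_pi_apply i)

lemma lintegral_mixedBinomialLaw (N : Measure ℕ) (ν : Measure E) {g : PointMeasure E → ℝ≥0∞}
    (hg : Measurable g) :
    ∫⁻ ξ, g ξ ∂mixedBinomialLaw N ν =
      ∫⁻ k, ∫⁻ z, g (config z) ∂(Measure.pi fun _ : Fin k ↦ ν) ∂N := by
  rw [mixedBinomialLaw, Measure.lintegral_bind Measurable.of_discrete.aemeasurable hg.aemeasurable]
  exact lintegral_congr fun k ↦ lintegral_map hg (measurable_config k)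

instance (N : Measure ℕ) (ν : Measure E) [IsProbabilityMeasure N] [IsProbabilityMeasure ν] :
    IsProbabilityMeasure (mixedBinomialLaw N ν) where
  measure_univ := by
    simpa using lintegral_mixedBinomialLaw N ν (g := 1) measurable_one

lemma integral_mixedBinomialLaw (N : Measure ℕ) (ν : Measure E) [IsProbabilityMeasure N]
    [IsProbabilityMeasure ν] {h : PointMeasure E → ℝ} (hm : Measurable h)
    (hosc : ∀ ξ η, |h ξ - h η| ≤ 1) :
    ∫ ξ, h ξ ∂mixedBinomialLaw N ν =
      ∫ k, ∫ z, h (config z) ∂(Measure.pi fun _ : Fin k ↦ ν) ∂N := by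
  obtain ⟨K, hK⟩ : ∃ K : Kernel ℕ (PointMeasure E),
      ⇑K = fun k ↦ (Measure.pi fun _ : Fin k ↦ ν).map config :=
    ⟨Kernel.ofFunOfCountable _, rfl⟩
  have hcomp : mixedBinomialLaw N ν = (K ∘ₖ Kernel.const Unit N) () := by
    rw [mixedBinomialLaw, ← hK, Measure.comp_eq_comp_const_apply]
  have hint := integrable_of_forall_abs_sub_le (mixedBinomialLaw N ν) hm hosc
  rw [hcomp] at hint ⊢
  rw [Kernel.integral_comp (κ := Kernel.const Unit N) (η := K) (a := ()) hint,
    Kernel.const_apply, hK]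
  exact integral_congr_ae <| .of_forall fun k ↦
    integral_map (measurable_config k).aemeasurable hm.aestronglyMeasurable

end MixedBinomial

section Sample

variable {E : Type*} [MeasurableSpace E]

lemma lintegral_pi_fin_succ (μ : Measure E) [SigmaFinite μ] (n : ℕ)
    {F : (Fin (n + 1) → E) → ℝ≥0∞} (hF : Measurable F) :
    ∫⁻ x, F x ∂(Measure.pi fun _ : Fin (n + 1) ↦ μ) =
      ∫⁻ a, ∫⁻ x, F (Fin.cons a x) ∂(Measure.pi fun _ : Fin n ↦ μ) ∂μ := by
  have hpres := (measurePreserving_piFinSuccAbove (fun _ : Fin (n + 1) ↦ μ) 0).symm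
  rw [← hpres.lintegral_comp hF]
  refine (lintegral_prod _ (hF.comp hpres.measurable).aemeasurable).trans ?_
  simp [MeasurableEquiv.piFinSuccAbove_symm_apply, Fin.insertNthEquiv]

lemma measurable_lintegral_addPoint_config (ν : Measure E) [SigmaFinite ν] (k : ℕ)
    {g : PointMeasure E → ℝ≥0∞} (hg : Measurable g) :
    Measurable fun a ↦ ∫⁻ z, g (addPoint a (config z)) ∂(Measure.pi fun _ : Fin k ↦ ν) := by
  have hcons : Measurable fun q : E × (Fin k → E) ↦ (Fin.cons q.1 q.2 : Fin (k + 1) → E) :=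
    measurable_pi_lambda _ <| Fin.cases measurable_fst
      fun j ↦ (measurable_pi_apply j).comp measurable_snd
  simp_rw [← config_cons]
  exact ((hg.comp (measurable_config (k + 1))).comp hcons).lintegral_prod_right'

lemma lintegral_mixedBinomialLaw_map_succ (N : Measure ℕ) [SFinite N] (ν : Measure E)
    [SigmaFinite ν] {g : PointMeasure E → ℝ≥0∞} (hg : Measurable g) :
    ∫⁻ ξ, g ξ ∂mixedBinomialLaw (N.map Nat.succ) ν =
      ∫⁻ a, ∫⁻ ξ, g (addPoint a ξ) ∂mixedBinomialLaw N ν ∂ν := by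
  have hmix (a : E) : ∫⁻ ξ, g (addPoint a ξ) ∂mixedBinomialLaw N ν =
      ∫⁻ k, ∫⁻ z, g (addPoint a (config z)) ∂(Measure.pi fun _ : Fin k ↦ ν) ∂N :=
    lintegral_mixedBinomialLaw N ν (hg.comp (measurable_addPoint a))
  simp_rw [hmix]
  rw [lintegral_mixedBinomialLaw _ ν hg, lintegral_map .of_discrete .of_discrete,
    lintegral_lintegral_swap (measurable_from_prod_countable_left fun k ↦
      measurable_lintegral_addPoint_config ν k hg).aemeasurable]
  refine lintegral_congr fun k ↦ ?_
  rw [lintegral_pi_fin_succ ν k (F := fun z ↦ g (config z)) (hg.comp (measurable_config _))]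
  simp_rw [config_cons]

lemma lintegral_mixedBinomialLaw_binomial_succ (n : ℕ) (p : I) (ν : Measure E) [SigmaFinite ν]
    {g : PointMeasure E → ℝ≥0∞} (hg : Measurable g) :
    ∫⁻ ξ, g ξ ∂mixedBinomialLaw Bin(n + 1, p) ν =
      ENNReal.ofReal (1 - p) * ∫⁻ ξ, g ξ ∂mixedBinomialLaw Bin(n, p) ν +
      ENNReal.ofReal p * ∫⁻ a, ∫⁻ ξ, g (addPoint a ξ) ∂mixedBinomialLaw Bin(n, p) ν ∂ν := by
  rw [lintegral_mixedBinomialLaw _ ν hg, binomial_succ, lintegral_add_measure,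
    lintegral_smul_measure, lintegral_smul_measure, ← lintegral_mixedBinomialLaw _ ν hg,
    ← lintegral_mixedBinomialLaw _ ν hg, lintegral_mixedBinomialLaw_map_succ _ ν hg]
  rfl

lemma lintegral_configIn_succ {A : Set E} (hA : MeasurableSet A) (μ : Measure E) [SigmaFinite μ]
    (n : ℕ) {g : PointMeasure A → ℝ≥0∞} (hg : Measurable g) :
    ∫⁻ x, g (configIn A x) ∂(Measure.pi fun _ : Fin (n + 1) ↦ μ) =
      μ Aᶜ * ∫⁻ x, g (configIn A x) ∂(Measure.pi fun _ : Fin n ↦ μ) +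
      ∫⁻ a, ∫⁻ x, g (addPoint a (configIn A x)) ∂(Measure.pi fun _ : Fin n ↦ μ)
        ∂(μ.comap (Subtype.val : A → E)) := by
  rw [lintegral_pi_fin_succ μ n (F := fun x ↦ g (configIn A x))
      (hg.comp (measurable_configIn hA _)), ← lintegral_add_compl _ hA,
    add_comm, ← lintegral_subtype_comap hA]
  refine congrArg₂ (· + ·) ?_ (lintegral_congr fun a ↦ ?_)
  · rw [mul_comm, ← setLIntegral_const]
    exact setLIntegral_congr_fun hA.compl fun a ha ↦ by
      simp only [configIn_cons_of_notMem (Set.notMem_of_mem_compl ha)]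
  · simp only [configIn_cons_of_mem a.2]

theorem map_configIn_eq_mixedBinomialLaw {A : Set E} (hA : MeasurableSet A) (μ : Measure E)
    [IsProbabilityMeasure μ] (ν : Measure A) [IsProbabilityMeasure ν] {p : I}
    (hμν : μ.comap Subtype.val = unitInterval.toNNReal p • ν) (n : ℕ) :
    (Measure.pi fun _ : Fin n ↦ μ).map (configIn A) = mixedBinomialLaw Bin(n, p) ν := by
  have hp : (unitInterval.toNNReal p : ℝ≥0∞) = ENNReal.ofReal p :=
    (ENNReal.ofReal_eq_coe_nnreal p.2.1).symm
  have hμA : μ A = ENNReal.ofReal p := by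
    simpa [comap_subtype_coe_apply hA, hp] using congrArg (fun ρ : Measure A ↦ ρ Set.univ) hμν
  have hμAc : μ Aᶜ = ENNReal.ofReal (1 - p) := by
    rw [prob_compl_eq_one_sub hA, hμA, ENNReal.ofReal_sub _ p.2.1, ENNReal.ofReal_one]
  induction n with
  | zero =>
    rw [binomial_zero, mixedBinomialLaw, Measure.dirac_bind .of_discrete, Measure.pi_of_empty,
      Measure.pi_of_empty, Measure.map_dirac' (measurable_configIn hA _),
      Measure.map_dirac' (measurable_config _)]
    exact congrArg Measure.dirac (Subtype.ext (by simp [configIn, config]))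
  | succ n ih =>
    have hlint {g : PointMeasure A → ℝ≥0∞} (hg : Measurable g) :
        ∫⁻ x, g (configIn A x) ∂(Measure.pi fun _ : Fin n ↦ μ) =
          ∫⁻ ξ, g ξ ∂mixedBinomialLaw Bin(n, p) ν := by
      rw [← ih, lintegral_map hg (measurable_configIn hA n)]
    refine Measure.ext_of_lintegral _ fun g hg ↦ ?_
    have hadd (a : A) : ∫⁻ x, g (addPoint a (configIn A x)) ∂(Measure.pi fun _ : Fin n ↦ μ) =
        ∫⁻ ξ, g (addPoint a ξ) ∂mixedBinomialLaw Bin(n, p) ν :=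
      hlint (hg.comp (measurable_addPoint a))
    rw [lintegral_map hg (measurable_configIn hA _), lintegral_configIn_succ hA μ n hg, hlint hg,
      lintegral_mixedBinomialLaw_binomial_succ n p ν hg, hμAc, hμν]
    simp_rw [hadd]
    rw [lintegral_smul_measure, ENNReal.smul_def, hp, smul_eq_mul]

end Sample

section Poisson

variable {E : Type*} [MeasurableSpace E]

lemma pi_smul (ν : Measure E) [SigmaFinite ν] (b : ℝ≥0) (k : ℕ) :
    (Measure.pi fun _ : Fin k ↦ b • ν) = b ^ k • Measure.pi fun _ : Fin k ↦ ν :=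
  Measure.pi_eq fun s _ ↦ by
    rw [Measure.smul_apply, Measure.pi_pi]
    simp only [Measure.smul_apply, ENNReal.smul_def, smul_eq_mul, Finset.prod_mul_distrib,
      Finset.prod_const, Finset.card_univ, Fintype.card_fin, ENNReal.coe_pow]

theorem PRM_smul_eq_mixedBinomialLaw (ν : Measure E) [IsProbabilityMeasure ν] (b : ℝ≥0) :
    PRM (b • ν) = mixedBinomialLaw Po(b) ν := by
  refine Measure.ext_of_lintegral _ fun g hg ↦ ?_
  rw [lintegral_mixedBinomialLaw _ _ hg, PRM, lintegral_sum_measure, poissonMeasure,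
    lintegral_sum_measure]
  refine tsum_congr fun k ↦ ?_
  have hreal : (b • ν).real Set.univ = b := by
    rw [measureReal_nnreal_smul_apply, probReal_univ, mul_one]
  rw [pi_smul, Measure.map_smul, lintegral_smul_measure, lintegral_smul_measure,
    lintegral_map hg (measurable_config k), lintegral_smul_measure, lintegral_dirac, hreal,
    ENNReal.smul_def, smul_eq_mul, smul_eq_mul, smul_eq_mul, ← mul_assoc]
  congr 1
  rw [ENNReal.coe_pow, ← ENNReal.ofReal_coe_nnreal, ← ENNReal.ofReal_pow b.coe_nonneg,
    ← ENNReal.ofReal_mul (by positivity)]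
  congr 1
  ring

end Poisson

section Distance

lemma integrable_pi_sum {E : Type*} [MeasurableSpace E] (ν : Measure E) [IsFiniteMeasure ν]
    {g : E → ℝ} (hg : Integrable g ν) (k : ℕ) :
    Integrable (fun z : Fin k → E ↦ ∑ i, g (z i)) (Measure.pi fun _ ↦ ν) :=
  integrable_finsetSum _ fun _ _ ↦ integrable_comp_eval (μ := fun _ ↦ ν) hg

lemma integral_pi_sum {E : Type*} [MeasurableSpace E] (ν : Measure E) [IsProbabilityMeasure ν]
    {g : E → ℝ} (hg : Integrable g ν) (k : ℕ) :
    ∫ z : Fin k → E, ∑ i, g (z i) ∂(Measure.pi fun _ ↦ ν) = k * ∫ z, g z ∂ν := by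
  rw [integral_finsetSum _ fun _ _ ↦ integrable_comp_eval (μ := fun _ ↦ ν) hg]
  simp_rw [fun i : Fin k ↦ integral_comp_eval (μ := fun _ ↦ ν) (i := i) hg.aestronglyMeasurable]
  simp

lemma d0_nonneg {E : Type*} [PseudoMetricSpace E] (x y : E) : 0 ≤ d0 x y :=
  le_min dist_nonneg zero_le_one

lemma integral_config {E : Type*} [MeasurableSpace E] [MeasurableSingletonClass E] {k : ℕ}
    (f : E → ℝ) (z : Fin k → E) : ∫ x, f x ∂(config z).1 = ∑ i, f (z i) := by
  simp only [config]
  rw [integral_finsetSum_measure fun i _ ↦ integrable_dirac (by simp)]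
  simp only [integral_dirac]

lemma d1_config_le {E : Type*} [PseudoMetricSpace E] [MeasurableSpace E]
    [MeasurableSingletonClass E] {k : ℕ} (z w : Fin k → E) :
    d1 (config z).1 (config w).1 ≤ (k : ℝ)⁻¹ * ∑ i, d0 (z i) (w i) := by
  have hcard (z : Fin k → E) : (config z).1 Set.univ = k := by
    simp [config, Measure.finsetSum_apply]
  rw [d1, if_pos ((hcard z).trans (hcard w).symm), measureReal_def, hcard, ENNReal.toReal_natCast]
  refine mul_le_mul_of_nonneg_left (Real.iSup_le (fun f ↦ ?_)
    (Finset.sum_nonneg fun i _ ↦ d0_nonneg _ _)) (by positivity)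
  rw [integral_config, integral_config, ← Finset.sum_sub_distrib]
  exact (Finset.abs_sum_le_sum_abs _ _).trans (Finset.sum_le_sum fun i _ ↦ f.2 _ _)

variable {E : Type*} [PseudoMetricSpace E] [MeasurableSpace E] [OpensMeasurableSpace E]

lemma abs_sub_le_one_of_abs_sub_le_d1 {h : PointMeasure E → ℝ}
    (hh : ∀ ξ η, |h ξ - h η| ≤ d1 ξ.1 η.1) (ξ η : PointMeasure E) : |h ξ - h η| ≤ 1 := by
  have : IsFiniteMeasure ξ.1 := ⟨measure_lt_top ξ _⟩
  have : IsFiniteMeasure η.1 := ⟨measure_lt_top η _⟩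
  exact (hh ξ η).trans (d1_le_one _ _)

variable [SecondCountableTopology E]

lemma integrable_d0 (ν : Measure E) [IsFiniteMeasure ν] {f : E → E} (hf : Measurable f) :
    Integrable (fun z ↦ d0 (f z) z) ν := by
  refine .of_bound ((hf.dist measurable_id).min measurable_const).aestronglyMeasurable 1
    (.of_forall fun z ↦ ?_)
  rw [Real.norm_of_nonneg (d0_nonneg _ _)]
  exact min_le_right _ _

variable [MeasurableSingletonClass E]

lemma abs_integral_config_map_sub_le (ν : Measure E) [IsProbabilityMeasure ν] {f : E → E}
    (hf : Measurable f) (k : ℕ) {h : PointMeasure E → ℝ} (hm : Measurable h)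
    (hh : ∀ ξ η, |h ξ - h η| ≤ d1 ξ.1 η.1) :
    |∫ z, h (config z) ∂(Measure.pi fun _ : Fin k ↦ ν.map f) -
      ∫ z, h (config z) ∂(Measure.pi fun _ : Fin k ↦ ν)| ≤ ∫ z, d0 (f z) z ∂ν := by
  have := Measure.isProbabilityMeasure_map (μ := ν) hf.aemeasurable
  have hosc := abs_sub_le_one_of_abs_sub_le_d1 hh
  have hfk : Measurable fun (z : Fin k → E) i ↦ f (z i) :=
    measurable_pi_lambda _ fun i ↦ hf.comp (measurable_pi_apply i)
  have hmk : Measurable fun z : Fin k → E ↦ h (config z) := hm.comp (measurable_config k)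
  have hmfk : Measurable fun z : Fin k → E ↦ h (config fun i ↦ f (z i)) := hmk.comp hfk
  rw [← Measure.pi_map_pi fun _ ↦ hf.aemeasurable,
    integral_map hfk.aemeasurable hmk.aestronglyMeasurable,
    ← integral_sub (integrable_of_forall_abs_sub_le _ hmfk fun _ _ ↦ hosc _ _)
      (integrable_of_forall_abs_sub_le _ hmk fun _ _ ↦ hosc _ _)]
  calc |∫ z, (h (config fun i ↦ f (z i)) - h (config z)) ∂(Measure.pi fun _ : Fin k ↦ ν)|
      ≤ ∫ z, |h (config fun i ↦ f (z i)) - h (config z)| ∂(Measure.pi fun _ : Fin k ↦ ν) :=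
        abs_integral_le_integral_abs
    _ ≤ ∫ z, (k : ℝ)⁻¹ * ∑ i, d0 (f (z i)) (z i) ∂(Measure.pi fun _ : Fin k ↦ ν) :=
        integral_mono_of_nonneg (.of_forall fun z ↦ abs_nonneg _)
          ((integrable_pi_sum ν (integrable_d0 ν hf) k).const_mul _)
          (.of_forall fun z ↦ (hh _ _).trans (d1_config_le _ _))
    _ = (k : ℝ)⁻¹ * k * ∫ z, d0 (f z) z ∂ν := by
        rw [integral_const_mul, integral_pi_sum ν (integrable_d0 ν hf), mul_assoc]
    _ ≤ ∫ z, d0 (f z) z ∂ν :=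
        mul_le_of_le_one_left (integral_nonneg fun z ↦ d0_nonneg _ _) inv_mul_le_one

end Distance

lemma abs_integral_config_sub_le_one {E : Type*} [MeasurableSpace E] (ν : Measure E)
    [IsProbabilityMeasure ν] {h : PointMeasure E → ℝ} (hm : Measurable h)
    (hosc : ∀ ξ η, |h ξ - h η| ≤ 1) (i j : ℕ) :
    |∫ z, h (config z) ∂(Measure.pi fun _ : Fin i ↦ ν) -
      ∫ z, h (config z) ∂(Measure.pi fun _ : Fin j ↦ ν)| ≤ 1 := by
  have hprob (k : ℕ) := Measure.isProbabilityMeasure_map (μ := Measure.pi fun _ : Fin k ↦ ν)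
    (measurable_config k).aemeasurable
  have hle := abs_integral_sub_le ((Measure.pi fun _ : Fin i ↦ ν).map config)
    ((Measure.pi fun _ : Fin j ↦ ν).map config) (by rw [measure_univ, measure_univ]) hm hosc
  rwa [integral_map (measurable_config i).aemeasurable hm.aestronglyMeasurable,
    integral_map (measurable_config j).aemeasurable hm.aestronglyMeasurable, probReal_univ] at hle

theorem d2_map_configIn_PRM_le {E : Type*} [PseudoMetricSpace E] [MeasurableSpace E]
    [OpensMeasurableSpace E] [SecondCountableTopology E] [MeasurableSingletonClass E]
    {A : Set E} (hA : MeasurableSet A) (μ : Measure E) [IsProbabilityMeasure μ]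
    (ν : Measure A) [IsProbabilityMeasure ν] {f : A → A} (hf : Measurable f) {p : I}
    (hμν : μ.comap Subtype.val = unitInterval.toNNReal p • ν.map f) {n : ℕ} {b : ℝ≥0}
    (hnp : n * unitInterval.toNNReal p ≤ b) :
    d2 ((Measure.pi fun _ : Fin n ↦ μ).map (configIn A)) (PRM (b • ν)) ≤
      p + min (b - n * p : ℝ) (√b - √(n * p)) + min (b : ℝ) 1 * ∫ z, d0 (f z) z ∂ν := by
  have := Measure.isProbabilityMeasure_map (μ := ν) hf.aemeasurable
  have hnp' : (n * p : ℝ) ≤ b := NNReal.coe_le_coe.2 hnp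
  have hpos : 0 ≤ p + min (b - n * p : ℝ) (√b - √(n * p)) + min (b : ℝ) 1 * ∫ z, d0 (f z) z ∂ν :=
    add_nonneg (add_nonneg p.2.1
      (le_min (sub_nonneg.2 hnp') (sub_nonneg.2 (Real.sqrt_le_sqrt hnp'))))
      (mul_nonneg (by positivity) (integral_nonneg fun z ↦ d0_nonneg _ _))
  refine Real.iSup_le (fun ⟨h, hm, hh⟩ ↦ ?_) hpos
  have hosc := abs_sub_le_one_of_abs_sub_le_d1 hh
  dsimp only
  rw [map_configIn_eq_mixedBinomialLaw hA μ (ν.map f) hμν, PRM_smul_eq_mixedBinomialLaw,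
    integral_mixedBinomialLaw _ _ hm hosc, integral_mixedBinomialLaw _ _ hm hosc]
  set H : ℕ → ℝ := fun k ↦ ∫ z, h (config z) ∂(Measure.pi fun _ : Fin k ↦ ν.map f)
  set K : ℕ → ℝ := fun k ↦ ∫ z, h (config z) ∂(Measure.pi fun _ : Fin k ↦ ν)
  have hH : ∀ i j, |H i - H j| ≤ 1 := abs_integral_config_sub_le_one _ hm hosc
  have hK : ∀ i j, |K i - K j| ≤ 1 := abs_integral_config_sub_le_one _ hm hosc
  have hHK : H 0 = K 0 := by simp_rw [H, K]; rw [Measure.pi_of_empty, Measure.pi_of_empty]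
  have binomial_poisson := abs_integral_binomial_sub_integral_poissonMeasure_le n p hH
  have poisson_poisson := le_min (abs_integral_poissonMeasure_sub_le hnp hH)
    (abs_integral_poissonMeasure_sub_le_sqrt hnp hH)
  have displacement := abs_integral_poissonMeasure_sub_le_min_mul b hH hK hHK
    fun k ↦ abs_integral_config_map_sub_le ν hf k hm hh
  exact (abs_sub_le _ _ _).trans (add_le_add ((abs_sub_le _ _ _).trans
    (add_le_add binomial_poisson poisson_poisson)) displacement)

end PointProcess

namespace MarshallOlkin

section ExponentialLaw

variable {β : ℝ}

lemma expMeasure_eq_withDensity (β : ℝ) :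
    expMeasure β = volume.withDensity (exponentialPDF β) := rfl

lemma measurable_exponentialPDF (β : ℝ) : Measurable (exponentialPDF β) :=
  (measurable_exponentialPDFReal β).ennreal_ofReal

instance (β : ℝ) : NullSingletonClass (expMeasure β) :=
  ⟨fun x ↦ withDensity_absolutelyContinuous _ _ (Real.volume_singleton (a := x))⟩

lemma expMeasure_Iic_zero (hβ : 0 < β) : expMeasure β (Set.Iic 0) = 0 := by
  have := isProbabilityMeasure_expMeasure hβ
  rw [← ofReal_cdf, cdf_expMeasure_eq hβ]
  simp

lemma ae_expMeasure_pos (hβ : 0 < β) : ∀ᵐ y ∂expMeasure β, 0 < y := by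
  simpa [ae_iff, ← Set.Iic_def] using expMeasure_Iic_zero hβ

lemma expMeasure_Ioc (hβ : 0 < β) {a b : ℝ} (ha : 0 ≤ a) (hb : 0 ≤ b) :
    expMeasure β (Set.Ioc a b) =
      ENNReal.ofReal (Real.exp (-(β * a)) - Real.exp (-(β * b))) := by
  have := isProbabilityMeasure_expMeasure hβ
  rw [← measure_cdf (expMeasure β), StieltjesFunction.measure_Ioc, cdf_expMeasure_eq hβ,
    cdf_expMeasure_eq hβ, if_pos ha, if_pos hb]
  congr 1
  ring

lemma expMeasure_Ioc_grid (hβ : 0 < β) {κ : ℝ} (hκ : 0 < κ) (j : ℕ) :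
    expMeasure β (Set.Ioc (j * κ) ((j + 1) * κ)) =
      ENNReal.ofReal (Real.exp (-(β * κ)) ^ j * (1 - Real.exp (-(β * κ)))) := by
  rw [expMeasure_Ioc hβ (by positivity) (by positivity), ← Real.exp_nat_mul, mul_sub, mul_one,
    ← Real.exp_add]
  ring_nf

lemma expMeasure_ceil_div (hβ : 0 < β) {κ : ℝ} (hκ : 0 < κ) (j : ℕ) :
    expMeasure β {y | ⌈y / κ⌉₊ = j + 1} =
      ENNReal.ofReal (Real.exp (-(β * κ)) ^ j * (1 - Real.exp (-(β * κ)))) := by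
  rw [← expMeasure_Ioc_grid hβ hκ]
  congr 1
  ext y
  simp [Nat.ceil_eq_iff, lt_div_iff₀ hκ, div_le_iff₀ hκ]

lemma expMeasure_floor_div (hβ : 0 < β) {r : ℝ} (hr : 0 < r) (m : ℕ) :
    expMeasure β {s | ⌊s / r⌋₊ = m} =
      ENNReal.ofReal (Real.exp (-(β * r)) ^ m * (1 - Real.exp (-(β * r)))) := by
  rw [← expMeasure_Ioc_grid hβ hr, ← measure_congr Ico_ae_eq_Ioc]
  refine measure_congr ?_
  filter_upwards [ae_expMeasure_pos hβ] with s hs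
  refine propext ?_
  change ⌊s / r⌋₊ = m ↔ s ∈ Set.Ico _ _
  rw [Nat.floor_eq_iff (by positivity), le_div_iff₀ hr, div_lt_iff₀ hr, Set.mem_Ico]

lemma lintegral_ofReal_expMeasure (hβ : 0 < β) :
    ∫⁻ y, ENNReal.ofReal |y| ∂expMeasure β = ENNReal.ofReal (1 / β) := by
  have mul_pdf (y : ℝ) : exponentialPDF β y * ENNReal.ofReal |y| =
      ENNReal.ofReal (1 / β) * gammaPDF 2 β y := by
    rw [exponentialPDF_eq, gammaPDF, gammaPDFReal]
    split_ifs with hy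
    · have hpow : y ^ ((2 : ℝ) - 1) = y := by norm_num
      rw [← ENNReal.ofReal_mul (by positivity), ← ENNReal.ofReal_mul (by positivity), hpow,
        abs_of_nonneg hy, Real.Gamma_two, Real.rpow_two]
      congr 1
      field_simp
    · simp
  rw [expMeasure_eq_withDensity, lintegral_withDensity_eq_lintegral_mul _
    (measurable_exponentialPDF β) (by fun_prop)]
  simp only [Pi.mul_apply, mul_pdf]
  rw [lintegral_const_mul' _ _ ENNReal.ofReal_ne_top, lintegral_gammaPDF_eq_one two_pos hβ,
    mul_one]

end ExponentialLaw

section ExcessLaw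

/-- The law of the signed excess `t - s` of a point `(s, t)` under the normalised limiting
intensity: it is exponential on either half-line and vanishes with probability
`1 / (1 + γ + δ)`. -/
noncomputable def excessMeasure (γ δ : ℝ) : Measure ℝ :=
  ENNReal.ofReal (γ / (1 + γ + δ)) • expMeasure ((1 + δ) / (1 + γ + δ)) +
    ENNReal.ofReal (δ / (1 + γ + δ)) • (expMeasure ((1 + γ) / (1 + γ + δ))).map Neg.neg +
    ENNReal.ofReal (1 / (1 + γ + δ)) • Measure.dirac 0

variable {γ δ : ℝ}

lemma excessMeasure_apply {B : Set ℝ} (hB : MeasurableSet B) :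
    excessMeasure γ δ B =
      ENNReal.ofReal (γ / (1 + γ + δ)) * expMeasure ((1 + δ) / (1 + γ + δ)) B +
      ENNReal.ofReal (δ / (1 + γ + δ)) * expMeasure ((1 + γ) / (1 + γ + δ)) (Neg.neg ⁻¹' B) +
      ENNReal.ofReal (1 / (1 + γ + δ)) * B.indicator 1 0 := by
  simp [excessMeasure, Measure.map_apply measurable_neg hB, Measure.dirac_apply' _ hB]

lemma isProbabilityMeasure_excessMeasure (hγ : 0 < γ) (hδ : 0 < δ) :
    IsProbabilityMeasure (excessMeasure γ δ) where
  measure_univ := by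
    have := isProbabilityMeasure_expMeasure (r := (1 + γ) / (1 + γ + δ)) (by positivity)
    have := isProbabilityMeasure_expMeasure (r := (1 + δ) / (1 + γ + δ)) (by positivity)
    rw [excessMeasure_apply .univ]
    simp only [Set.preimage_univ, measure_univ, Set.indicator_univ, Pi.one_apply, mul_one]
    rw [← ENNReal.ofReal_add (by positivity) (by positivity),
      ← ENNReal.ofReal_add (by positivity) (by positivity), ← ENNReal.ofReal_one]
    congr 1
    field_simp
    ring

lemma lintegral_abs_excessMeasure (hγ : 0 < γ) (hδ : 0 < δ) :
    ∫⁻ y, ENNReal.ofReal |y| ∂excessMeasure γ δ =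
      ENNReal.ofReal (γ / (1 + δ) + δ / (1 + γ)) := by
  rw [excessMeasure, lintegral_add_measure, lintegral_add_measure, lintegral_smul_measure,
    lintegral_smul_measure, lintegral_smul_measure, lintegral_dirac,
    lintegral_map (by fun_prop) measurable_neg]
  simp only [abs_neg]
  rw [lintegral_ofReal_expMeasure (by positivity), lintegral_ofReal_expMeasure (by positivity)]
  simp only [abs_zero, ENNReal.ofReal_zero, smul_eq_mul, mul_zero, add_zero]
  rw [← ENNReal.ofReal_mul (by positivity), ← ENNReal.ofReal_mul (by positivity),
    ← ENNReal.ofReal_add (by positivity) (by positivity)]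
  congr 1
  field_simp

/-- Rounds a signed excess up in absolute value to a multiple of `κ₂` if it is positive, and of
`κ₁` if it is negative; the two components count the multiples in either direction, as the
coordinates `1` and `0` of a point exceed their minimum by the positive and negative part of the
excess. -/
noncomputable def excessCell (κ₁ κ₂ y : ℝ) : ℕ × ℕ := (⌈-y / κ₁⌉₊, ⌈y / κ₂⌉₊)

variable {κ₁ κ₂ : ℝ}

lemma measurable_excessCell (κ₁ κ₂ : ℝ) : Measurable (excessCell κ₁ κ₂) :=
  (Nat.measurable_ceil.comp (measurable_neg.div_const κ₁)).prodMk
    (Nat.measurable_ceil.comp (measurable_id.div_const κ₂))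

lemma excessCell_neg (κ₁ κ₂ y : ℝ) : excessCell κ₁ κ₂ (-y) = (excessCell κ₂ κ₁ y).swap := by
  simp [excessCell]

lemma excessCell_of_nonneg (hκ₁ : 0 < κ₁) {y : ℝ} (hy : 0 ≤ y) :
    excessCell κ₁ κ₂ y = (0, ⌈y / κ₂⌉₊) := by
  rw [excessCell, Nat.ceil_eq_zero.2 (div_nonpos_of_nonpos_of_nonneg (neg_nonpos.2 hy) hκ₁.le)]

lemma excessCell_fst_eq_zero_or_snd_eq_zero (hκ₁ : 0 < κ₁) (hκ₂ : 0 < κ₂) (y : ℝ) :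
    (excessCell κ₁ κ₂ y).1 = 0 ∨ (excessCell κ₁ κ₂ y).2 = 0 := by
  rcases le_total 0 y with hy | hy
  · simp [excessCell_of_nonneg hκ₁ hy]
  · refine .inr (Nat.ceil_eq_zero.2 (div_nonpos_of_nonpos_of_nonneg hy hκ₂.le))

lemma expMeasure_preimage_excessCell {β : ℝ} (hβ : 0 < β) (hκ₁ : 0 < κ₁) (c : ℕ × ℕ) :
    expMeasure β (excessCell κ₁ κ₂ ⁻¹' {c}) =
      if c.1 = 0 then expMeasure β {y | ⌈y / κ₂⌉₊ = c.2} else 0 := by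
  have cell : excessCell κ₁ κ₂ ⁻¹' {c} =ᵐ[expMeasure β] {y | c.1 = 0 ∧ ⌈y / κ₂⌉₊ = c.2} := by
    filter_upwards [ae_expMeasure_pos hβ] with y hy
    refine propext ?_
    change excessCell κ₁ κ₂ y = c ↔ c.1 = 0 ∧ ⌈y / κ₂⌉₊ = c.2
    rw [excessCell_of_nonneg hκ₁ hy.le, Prod.ext_iff, eq_comm (a := (0, _).1)]
  rw [measure_congr cell]
  split_ifs with hc <;> simp [hc]

lemma expMeasure_ceil_div_eq_zero {β : ℝ} (hβ : 0 < β) {κ : ℝ} (hκ : 0 < κ) :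
    expMeasure β {y | ⌈y / κ⌉₊ = 0} = 0 := by
  rw [← expMeasure_Iic_zero hβ]
  congr 1
  ext y
  simp [div_le_iff₀ hκ]

lemma neg_preimage_excessCell (c : ℕ × ℕ) :
    Neg.neg ⁻¹' (excessCell κ₁ κ₂ ⁻¹' {c}) = excessCell κ₂ κ₁ ⁻¹' {c.swap} := by
  ext y
  simp [excessCell_neg, Prod.ext_iff, and_comm]

lemma excessMeasure_excessCell_zero (hγ : 0 < γ) (hδ : 0 < δ) (hκ₁ : 0 < κ₁) (hκ₂ : 0 < κ₂) :
    excessMeasure γ δ (excessCell κ₁ κ₂ ⁻¹' {(0, 0)}) = ENNReal.ofReal (1 / (1 + γ + δ)) := by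
  have h0 : (0 : ℝ) ∈ excessCell κ₁ κ₂ ⁻¹' {(0, 0)} := by simp [excessCell]
  rw [excessMeasure_apply (measurable_excessCell _ _ (measurableSet_singleton _)),
    neg_preimage_excessCell, expMeasure_preimage_excessCell (by positivity) hκ₁,
    expMeasure_preimage_excessCell (by positivity) hκ₂, Set.indicator_of_mem h0]
  dsimp only [Prod.swap]
  rw [if_pos rfl, if_pos rfl, expMeasure_ceil_div_eq_zero (by positivity) hκ₁,
    expMeasure_ceil_div_eq_zero (by positivity) hκ₂]
  simp

lemma excessMeasure_excessCell_snd (hγ : 0 < γ) (hδ : 0 < δ) (hκ₁ : 0 < κ₁) (hκ₂ : 0 < κ₂)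
    (j : ℕ) :
    excessMeasure γ δ (excessCell κ₁ κ₂ ⁻¹' {(0, j + 1)}) =
      ENNReal.ofReal (γ / (1 + γ + δ)) *
        ENNReal.ofReal (Real.exp (-((1 + δ) / (1 + γ + δ) * κ₂)) ^ j *
          (1 - Real.exp (-((1 + δ) / (1 + γ + δ) * κ₂)))) := by
  have h0 : (0 : ℝ) ∉ excessCell κ₁ κ₂ ⁻¹' {(0, j + 1)} := by simp [excessCell]
  rw [excessMeasure_apply (measurable_excessCell _ _ (measurableSet_singleton _)),
    neg_preimage_excessCell, expMeasure_preimage_excessCell (by positivity) hκ₁,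
    expMeasure_preimage_excessCell (by positivity) hκ₂, Set.indicator_of_notMem h0,
    ← expMeasure_ceil_div (by positivity) hκ₂]
  simp

lemma excessMeasure_excessCell_fst (hγ : 0 < γ) (hδ : 0 < δ) (hκ₁ : 0 < κ₁) (hκ₂ : 0 < κ₂)
    (i : ℕ) :
    excessMeasure γ δ (excessCell κ₁ κ₂ ⁻¹' {(i + 1, 0)}) =
      ENNReal.ofReal (δ / (1 + γ + δ)) *
        ENNReal.ofReal (Real.exp (-((1 + γ) / (1 + γ + δ) * κ₁)) ^ i *
          (1 - Real.exp (-((1 + γ) / (1 + γ + δ) * κ₁)))) := by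
  have h0 : (0 : ℝ) ∉ excessCell κ₁ κ₂ ⁻¹' {(i + 1, 0)} := by simp [excessCell]
  rw [excessMeasure_apply (measurable_excessCell _ _ (measurableSet_singleton _)),
    neg_preimage_excessCell, expMeasure_preimage_excessCell (by positivity) hκ₁,
    expMeasure_preimage_excessCell (by positivity) hκ₂, Set.indicator_of_notMem h0,
    ← expMeasure_ceil_div (by positivity) hκ₁]
  simp

end ExcessLaw

section GeometricLaw

variable {γ δ p₁₁ q₁ q₂ p₀₀ : ℝ}

lemma geometricLaw_singleton (q₁ q₂ p₀₀ : ℝ) (x : ℕ × ℕ) :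
    geometricLaw q₁ q₂ p₀₀ {x} = ENNReal.ofReal (geometricPMF q₁ q₂ p₀₀ x) :=
  Measure.sum_smul_dirac_singleton

lemma geometricPMF_add_diag (q₁ q₂ p₀₀ : ℝ) (x : ℕ × ℕ) (k : ℕ) :
    geometricPMF q₁ q₂ p₀₀ (x + (k, k)) = p₀₀ ^ k * geometricPMF q₁ q₂ p₀₀ x := by
  simp only [geometricPMF, Prod.fst_add, Prod.snd_add, add_lt_add_iff_right,
    Nat.add_right_cancel_iff, Nat.add_sub_add_right, pow_add]
  split_ifs <;> ring

theorem restrict_geometricLaw (hp₀₀ : 0 ≤ p₀₀) (q₁ q₂ : ℝ) (k : ℕ) :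
    (geometricLaw q₁ q₂ p₀₀).restrict {x | k ≤ x.1 ∧ k ≤ x.2} =
      ENNReal.ofReal (p₀₀ ^ k) • (geometricLaw q₁ q₂ p₀₀).map (· + (k, k)) := by
  refine Measure.ext_of_singleton fun x ↦ ?_
  rw [Measure.restrict_apply (measurableSet_singleton x), Measure.smul_apply, smul_eq_mul,
    Measure.map_apply .of_discrete (measurableSet_singleton x)]
  by_cases hx : k ≤ x.1 ∧ k ≤ x.2
  · obtain ⟨y, rfl⟩ : ∃ y : ℕ × ℕ, x = y + (k, k) :=
      ⟨(x.1 - k, x.2 - k), Prod.ext (Nat.sub_add_cancel hx.1).symm (Nat.sub_add_cancel hx.2).symm⟩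
    have preimage : (· + (k, k)) ⁻¹' {y + (k, k)} = {y} := by ext; simp
    have inter : {y + (k, k)} ∩ {x : ℕ × ℕ | k ≤ x.1 ∧ k ≤ x.2} = {y + (k, k)} := by simp
    rw [preimage, inter, geometricLaw_singleton, geometricLaw_singleton, geometricPMF_add_diag,
      ENNReal.ofReal_mul (by positivity)]
  · have preimage : (· + (k, k)) ⁻¹' {x} = (∅ : Set (ℕ × ℕ)) := by
      refine Set.eq_empty_of_forall_notMem fun y hy ↦ hx ?_
      rw [← Set.mem_singleton_iff.1 hy]
      exact ⟨Nat.le_add_left _ _, Nat.le_add_left _ _⟩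
    have inter : {x} ∩ {x : ℕ × ℕ | k ≤ x.1 ∧ k ≤ x.2} = ∅ := by
      simpa using hx
    simp only [preimage, inter, measure_empty, mul_zero]

lemma geometricPMF_diag (hM : 1 + γ + δ ≠ 0) (hq₁ : q₁ = 1 - (1 + γ) * p₁₁)
    (hq₂ : q₂ = 1 - (1 + δ) * p₁₁) (hp₀₀ : p₀₀ = 1 - (1 + γ + δ) * p₁₁) (m : ℕ) :
    geometricPMF q₁ q₂ p₀₀ (m, m) = p₀₀ ^ m * (1 - p₀₀) * (1 / (1 + γ + δ)) := by
  have mass : (1 - p₀₀) * (1 / (1 + γ + δ)) = 1 - q₁ - q₂ + p₀₀ := by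
    rw [hp₀₀, hq₂, hq₁]
    field_simp
    ring
  simp only [geometricPMF, lt_irrefl, if_false, if_true, mul_assoc, mass]

lemma geometricPMF_above_diag (hM : 1 + γ + δ ≠ 0) (hq₂ : q₂ = 1 - (1 + δ) * p₁₁)
    (hp₀₀ : p₀₀ = 1 - (1 + γ + δ) * p₁₁) (hq₂_ne : q₂ ≠ 0) (q₁ : ℝ) (m j : ℕ) :
    geometricPMF q₁ q₂ p₀₀ (m, m + (j + 1)) =
      p₀₀ ^ m * (1 - p₀₀) * (γ / (1 + γ + δ) * (q₂ ^ j * (1 - q₂))) := by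
  have mass : (1 - p₀₀) * (γ / (1 + γ + δ)) = q₂ - p₀₀ := by
    rw [hp₀₀, hq₂]
    field_simp
    ring
  have factor : q₂ * (1 - p₀₀ / q₂ - q₂ + p₀₀) = (q₂ - p₀₀) * (1 - q₂) := by
    field_simp
    ring
  simp only [geometricPMF, if_pos (show m < m + (j + 1) by omega), Nat.add_sub_cancel_left]
  linear_combination p₀₀ ^ m * q₂ ^ j * factor - p₀₀ ^ m * q₂ ^ j * (1 - q₂) * mass

lemma geometricPMF_swap (q₁ q₂ p₀₀ : ℝ) (x : ℕ × ℕ) :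
    geometricPMF q₁ q₂ p₀₀ x.swap = geometricPMF q₂ q₁ p₀₀ x := by
  simp only [geometricPMF, Prod.fst_swap, Prod.snd_swap]
  rcases lt_trichotomy x.1 x.2 with h | h | h
  · rw [if_neg h.asymm, if_neg h.ne', if_pos h]
    ring
  · simp only [h, lt_irrefl, if_false, if_true]
    ring
  · rw [if_pos h, if_neg h.asymm, if_neg h.ne']
    ring

lemma geometricPMF_below_diag (hM : 1 + γ + δ ≠ 0) (hq₁ : q₁ = 1 - (1 + γ) * p₁₁)
    (hp₀₀ : p₀₀ = 1 - (1 + γ + δ) * p₁₁) (hq₁_ne : q₁ ≠ 0) (q₂ : ℝ) (m i : ℕ) :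
    geometricPMF q₁ q₂ p₀₀ (m + (i + 1), m) =
      p₀₀ ^ m * (1 - p₀₀) * (δ / (1 + γ + δ) * (q₁ ^ i * (1 - q₁))) := by
  rw [add_right_comm] at hM hp₀₀
  rw [← Prod.swap_prod_mk, geometricPMF_swap, geometricPMF_above_diag hM hq₁ hp₀₀ hq₁_ne,
    add_right_comm]

end GeometricLaw

section Plane

lemma measurable_mk : Measurable fun p : ℝ × ℝ ↦ (!₂[p.1, p.2] : Plane) := by
  refine (WithLp.measurable_toLp 2 (Fin 2 → ℝ)).comp (measurable_pi_lambda _ fun i ↦ ?_)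
  fin_cases i
  · exact measurable_fst
  · exact measurable_snd

lemma measurable_coord (i : Fin 2) : Measurable fun z : Plane ↦ z i :=
  (measurable_pi_apply i).comp (WithLp.measurable_ofLp 2 (Fin 2 → ℝ))

lemma measurableSet_quadrant (u : ℝ) : MeasurableSet (quadrant u) :=
  (measurableSet_le measurable_const (measurable_coord 0)).inter
    (measurableSet_le measurable_const (measurable_coord 1))

lemma lintegral_plane {G : Plane → ℝ≥0∞} (hG : Measurable G) :
    ∫⁻ z, G z = ∫⁻ s : ℝ, ∫⁻ t : ℝ, G !₂[s, t] := by
  have hmp := (volume_preserving_finTwoArrow ℝ).comp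
    (EuclideanSpace.volume_preserving_symm_measurableEquiv_toLp (Fin 2))
  have h := hmp.lintegral_comp (hG.comp measurable_mk)
  rw [Measure.volume_eq_prod, lintegral_prod _ (hG.comp measurable_mk).aemeasurable] at h
  refine Eq.trans (lintegral_congr fun z ↦ ?_) h
  congr 1
  ext i
  fin_cases i <;> rfl

/-- The point of the plane with smaller coordinate `p.1` and signed excess `p.2` of the second
coordinate over the first. In these coordinates the limiting intensity is a product measure. -/
noncomputable def ofMinExcess (p : ℝ × ℝ) : Plane := !₂[p.1 + p.2⁻, p.1 + p.2⁺]

lemma ofMinExcess_zero (p : ℝ × ℝ) : ofMinExcess p 0 = p.1 + p.2⁻ := rfl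

lemma ofMinExcess_one (p : ℝ × ℝ) : ofMinExcess p 1 = p.1 + p.2⁺ := rfl

lemma ofMinExcess_one_sub_zero (p : ℝ × ℝ) : ofMinExcess p 1 - ofMinExcess p 0 = p.2 := by
  rw [ofMinExcess_zero, ofMinExcess_one, add_sub_add_left_eq_sub, posPart_sub_negPart]

lemma min_ofMinExcess (p : ℝ × ℝ) : min (ofMinExcess p 0) (ofMinExcess p 1) = p.1 := by
  rw [ofMinExcess_zero, ofMinExcess_one, min_add_add_left]
  rcases le_total 0 p.2 with h | h
  · simp [h]
  · simp [h]

lemma ofMinExcess_mem_quadrant {u : ℝ} {p : ℝ × ℝ} : ofMinExcess p ∈ quadrant u ↔ u ≤ p.1 := by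
  rw [← min_ofMinExcess p, le_min_iff]
  rfl

lemma measurable_ofMinExcess : Measurable ofMinExcess :=
  measurable_mk.comp <| (measurable_fst.add (by fun_prop)).prodMk (measurable_fst.add (by fun_prop))

end Plane

section Intensity

lemma lintegral_comp_ofMinExcess_snd (G : Plane → ℝ≥0∞) (s : ℝ) :
    ∫⁻ y in Set.Ioi 0, G (ofMinExcess (s, y)) = ∫⁻ t in Set.Ioi s, G !₂[s, t] := by
  rw [← (measurePreserving_add_left volume s).setLIntegral_comp_preimage_emb
    (measurableEmbedding_addLeft s) _ (Set.Ioi s)]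
  have preimage : (s + ·) ⁻¹' Set.Ioi s = Set.Ioi 0 := by simp
  rw [preimage]
  refine setLIntegral_congr_fun measurableSet_Ioi fun y (hy : 0 < y) ↦ ?_
  simp [ofMinExcess, posPart_of_nonneg hy.le, negPart_of_nonneg hy.le]

lemma lintegral_comp_ofMinExcess_fst (G : Plane → ℝ≥0∞) (t : ℝ) :
    ∫⁻ y in Set.Iic 0, G (ofMinExcess (t, y)) = ∫⁻ s in Set.Ici t, G !₂[s, t] := by
  rw [← (Measure.measurePreserving_sub_left volume t).setLIntegral_comp_preimage_emb
    (MeasurableEquiv.subLeft t).measurableEmbedding _ (Set.Ici t)]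
  have preimage : (t - ·) ⁻¹' Set.Ici t = Set.Iic 0 := by simp
  rw [preimage]
  refine setLIntegral_congr_fun measurableSet_Iic fun y (hy : y ≤ 0) ↦ ?_
  simp [ofMinExcess, posPart_of_nonpos hy, negPart_of_nonpos hy, sub_eq_add_neg]

theorem measurePreserving_ofMinExcess :
    MeasurePreserving ofMinExcess (volume.prod volume) volume := by
  refine ⟨measurable_ofMinExcess, Measure.ext_of_lintegral _ fun G hG ↦ ?_⟩
  have hG' : Measurable fun p : ℝ × ℝ ↦ G !₂[p.1, p.2] := hG.comp measurable_mk
  have swap : ∫⁻ t, ∫⁻ s in Set.Ici t, G !₂[s, t] = ∫⁻ s, ∫⁻ t in Set.Iic s, G !₂[s, t] := by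
    simp_rw [← lintegral_indicator measurableSet_Ici, ← lintegral_indicator measurableSet_Iic]
    rw [lintegral_lintegral_swap]
    · rfl
    · exact (hG'.comp measurable_swap).indicator
        (measurableSet_le measurable_fst measurable_snd) |>.aemeasurable
  rw [lintegral_map hG measurable_ofMinExcess,
    lintegral_prod (fun p ↦ G (ofMinExcess p)) (hG.comp measurable_ofMinExcess).aemeasurable,
    lintegral_plane hG]
  calc ∫⁻ s, ∫⁻ y, G (ofMinExcess (s, y))
      = ∫⁻ s, ((∫⁻ y in Set.Iic 0, G (ofMinExcess (s, y))) +
          ∫⁻ y in Set.Ioi 0, G (ofMinExcess (s, y))) := by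
        simp_rw [← Set.compl_Iic, lintegral_add_compl _ measurableSet_Iic]
    _ = (∫⁻ t, ∫⁻ s in Set.Ici t, G !₂[s, t]) + ∫⁻ s, ∫⁻ t in Set.Ioi s, G !₂[s, t] := by
        simp_rw [lintegral_comp_ofMinExcess_fst, lintegral_comp_ofMinExcess_snd]
        rw [lintegral_add_right]
        simp_rw [← lintegral_indicator measurableSet_Ioi]
        exact (hG'.indicator (measurableSet_lt measurable_fst measurable_snd)).lintegral_prod_right'
    _ = ∫⁻ s, ((∫⁻ t in Set.Iic s, G !₂[s, t]) + ∫⁻ t in Set.Ioi s, G !₂[s, t]) := by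
        rw [swap, lintegral_add_right]
        simp_rw [← lintegral_indicator measurableSet_Ioi]
        exact (hG'.indicator (measurableSet_lt measurable_fst measurable_snd)).lintegral_prod_right'
    _ = ∫⁻ s, ∫⁻ t, G !₂[s, t] := by
        simp_rw [← Set.compl_Iic, lintegral_add_compl _ measurableSet_Iic]

end Intensity

section Product

lemma map_withDensity_comp {X Y : Type*} [MeasurableSpace X] [MeasurableSpace Y] {μ : Measure X}
    {ν : Measure Y} {f : X → Y} (hf : MeasurePreserving f μ ν) {g : Y → ℝ≥0∞}
    (hg : Measurable g) : (μ.withDensity (g ∘ f)).map f = ν.withDensity g := by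
  ext B hB
  rw [Measure.map_apply hf.measurable hB, withDensity_apply _ (hf.measurable hB),
    withDensity_apply _ hB]
  exact hf.setLIntegral_comp_preimage hB hg

/-- The density of `excessMeasure` away from `0`. -/
noncomputable def excessPDF (γ δ y : ℝ) : ℝ≥0∞ :=
  ENNReal.ofReal (γ / (1 + γ + δ)) * exponentialPDF ((1 + δ) / (1 + γ + δ)) y +
    ENNReal.ofReal (δ / (1 + γ + δ)) * exponentialPDF ((1 + γ) / (1 + γ + δ)) (-y)

variable {γ δ : ℝ}

lemma measurable_excessPDF (γ δ : ℝ) : Measurable (excessPDF γ δ) :=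
  ((measurable_exponentialPDF _).const_mul _).add
    (((measurable_exponentialPDF _).comp measurable_neg).const_mul _)

lemma map_neg_withDensity {g : ℝ → ℝ≥0∞} (hg : Measurable g) :
    (volume.withDensity g).map Neg.neg = volume.withDensity fun y ↦ g (-y) := by
  rw [← map_withDensity_comp (Measure.measurePreserving_neg volume)
    (g := fun y ↦ g (-y)) (by fun_prop)]
  simp [Function.comp_def]

lemma excessMeasure_eq_withDensity_add_dirac (γ δ : ℝ) :
    excessMeasure γ δ = volume.withDensity (excessPDF γ δ) +
      ENNReal.ofReal (1 / (1 + γ + δ)) • Measure.dirac 0 := by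
  have hpdf (β : ℝ) := measurable_exponentialPDF β
  change _ = volume.withDensity ((ENNReal.ofReal _ • exponentialPDF _) +
    ENNReal.ofReal _ • fun y ↦ exponentialPDF _ (-y)) + _
  rw [withDensity_add_left ((hpdf _).const_smul _), withDensity_smul _ (hpdf _),
    withDensity_smul _ (f := fun y ↦ exponentialPDF _ (-y)) ((hpdf _).comp measurable_neg),
    ← map_neg_withDensity (hpdf _)]
  rfl

lemma measurable_offDiagonalIntensity (γ δ : ℝ) : Measurable (offDiagonalIntensity γ δ) := by
  have h (i : Fin 2) := measurable_coord i
  refine Measurable.ite (measurableSet_lt (h 0) (h 1)) (by fun_prop) ?_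
  exact Measurable.ite (measurableSet_lt (h 1) (h 0)) (by fun_prop) measurable_const

lemma ofReal_offDiagonalIntensity_ofMinExcess (hγ : 0 < γ) (hδ : 0 < δ) (s : ℝ) {y : ℝ}
    (hy : y ≠ 0) :
    ENNReal.ofReal (offDiagonalIntensity γ δ (ofMinExcess (s, y))) =
      ENNReal.ofReal (Real.exp (-s)) * excessPDF γ δ y := by
  have hM : 1 + γ + δ ≠ 0 := by positivity
  rw [offDiagonalIntensity, ofMinExcess_zero, ofMinExcess_one, excessPDF, exponentialPDF_eq,
    exponentialPDF_eq]
  rcases hy.lt_or_gt with hy | hy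
  · have exponent : -((1 + γ) / (1 + γ + δ)) * (s + -y) + -(δ / (1 + γ + δ)) * (s + 0) =
        -s + -((1 + γ) / (1 + γ + δ) * -y) := by
      field_simp
      ring
    rw [posPart_of_nonpos hy.le, negPart_of_nonpos hy.le, if_neg (by dsimp; linarith),
      if_pos (by dsimp; linarith), if_neg hy.not_ge, if_pos (by linarith), mul_assoc,
      ← Real.exp_add, exponent, Real.exp_add, ENNReal.ofReal_zero, mul_zero, zero_add,
      ← ENNReal.ofReal_mul (by positivity), ← ENNReal.ofReal_mul (Real.exp_nonneg _)]
    congr 1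
    field_simp
  · have exponent : -(γ / (1 + γ + δ)) * (s + 0) + -((1 + δ) / (1 + γ + δ)) * (s + y) =
        -s + -((1 + δ) / (1 + γ + δ) * y) := by
      field_simp
      ring
    rw [posPart_of_nonneg hy.le, negPart_of_nonneg hy.le, if_pos (by dsimp; linarith),
      if_pos hy.le, if_neg (by linarith), mul_assoc, ← Real.exp_add, exponent, Real.exp_add,
      ENNReal.ofReal_zero, mul_zero, add_zero, ← ENNReal.ofReal_mul (by positivity),
      ← ENNReal.ofReal_mul (Real.exp_nonneg _)]
    congr 1
    field_simp

theorem intensityMeasure_eq_map_prod (hγ : 0 < γ) (hδ : 0 < δ) :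
    intensityMeasure γ δ =
      ((volume.withDensity fun s ↦ ENNReal.ofReal (Real.exp (-s))).prod
        (excessMeasure γ δ)).map ofMinExcess := by
  have hexp : Measurable fun s : ℝ ↦ ENNReal.ofReal (Real.exp (-s)) := by fun_prop
  rw [excessMeasure_eq_withDensity_add_dirac, Measure.prod_add, Measure.map_add _ _
    measurable_ofMinExcess, intensityMeasure]
  congr 1
  · rw [prod_withDensity hexp (measurable_excessPDF γ δ),
      ← map_withDensity_comp measurePreserving_ofMinExcess
        (measurable_offDiagonalIntensity γ δ).ennreal_ofReal]
    congr 1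
    refine withDensity_congr_ae ?_
    have hy : ∀ᵐ p : ℝ × ℝ ∂volume.prod volume, p.2 ≠ 0 :=
      Measure.quasiMeasurePreserving_snd.ae (Measure.ae_ne volume 0)
    filter_upwards [hy] with p hp
    exact ofReal_offDiagonalIntensity_ofMinExcess hγ hδ p.1 hp
  · have diagonal : (volume.withDensity fun s ↦ ENNReal.ofReal (diagonalIntensity γ δ s)) =
        ENNReal.ofReal (1 / (1 + γ + δ)) •
          volume.withDensity fun s : ℝ ↦ ENNReal.ofReal (Real.exp (-s)) := by
      rw [← withDensity_smul _ hexp]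
      congr 1 with s
      exact ENNReal.ofReal_mul (by positivity)
    rw [diagonal, Measure.prod_smul_right, Measure.prod_dirac, Measure.map_smul, Measure.map_smul,
      Measure.map_map measurable_ofMinExcess (by fun_prop)]
    simp [Function.comp_def, ofMinExcess]

end Product

section Subspace

variable {X : Type*} [MeasurableSpace X] {A : Set X}

lemma comap_val_eq_smul (hA : MeasurableSet A) {μ ρ : Measure X} {c : ℝ≥0}
    (h : μ.restrict A = c • ρ) :
    μ.comap (Subtype.val : A → X) = c • ρ.comap Subtype.val := by
  ext B _
  have subset : Subtype.val '' B ⊆ A := Subtype.coe_image_subset A B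
  rw [Measure.smul_apply, comap_subtype_coe_apply hA, comap_subtype_coe_apply hA,
    ← Measure.restrict_eq_self μ subset, h, Measure.smul_apply]

lemma comap_val_map (hA : MeasurableSet A) {ρ : Measure X} (hρ : ∀ᵐ z ∂ρ, z ∈ A) {g : X → X}
    (hg : Measurable g) (hgA : Set.MapsTo g A A) :
    (ρ.map g).comap (Subtype.val : A → X) =
      (ρ.comap Subtype.val).map (hgA.restrict g A A) := by
  ext B hB
  have hgA' : Measurable (hgA.restrict g A A) := (hg.comp measurable_subtype_coe).subtype_mk
  rw [Measure.map_apply hgA' hB, comap_subtype_coe_apply hA, comap_subtype_coe_apply hA,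
    Measure.map_apply hg (hA.subtype_image hB)]
  refine measure_congr ?_
  filter_upwards [hρ] with z hz
  refine propext ⟨?_, ?_⟩
  · rintro ⟨w, hw, hwz⟩
    obtain rfl : w = hgA.restrict g A A ⟨z, hz⟩ := Subtype.ext hwz
    exact ⟨⟨z, hz⟩, hw, rfl⟩
  · rintro ⟨w, hw, rfl⟩
    exact ⟨_, hw, rfl⟩

end Subspace

section LimitLaw

lemma restrict_Ici_withDensity_exp_neg (u : ℝ) :
    (volume.withDensity fun s ↦ ENNReal.ofReal (Real.exp (-s))).restrict (Set.Ici u) =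
      ENNReal.ofReal (Real.exp (-u)) • (expMeasure 1).map (u + ·) := by
  have hpdf : Measurable fun s ↦ exponentialPDF 1 (-u + s) :=
    (measurable_exponentialPDF 1).comp (measurable_const_add _)
  have shift : (expMeasure 1).map (u + ·) =
      volume.withDensity fun s ↦ exponentialPDF 1 (-u + s) := by
    rw [← map_withDensity_comp (measurePreserving_add_left volume u) hpdf]
    simp [Function.comp_def, expMeasure_eq_withDensity]
  rw [shift, ← withDensity_smul _ hpdf, restrict_withDensity measurableSet_Ici,
    ← withDensity_indicator measurableSet_Ici]
  congr 1 with s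
  rw [Pi.smul_apply, smul_eq_mul, exponentialPDF_eq]
  by_cases hs : u ≤ s
  · rw [Set.indicator_of_mem (Set.mem_Ici.2 hs), if_pos (by linarith),
      ← ENNReal.ofReal_mul (Real.exp_nonneg _), one_mul, one_mul, ← Real.exp_add]
    ring_nf
  · rw [Set.indicator_of_notMem (by simpa using hs), if_neg (by linarith)]
    simp

/-- The limiting intensity on `[u, ∞)²`, normalised to a probability measure: the smaller
coordinate exceeds `u` by a standard exponential variable, and the signed excess of the second
coordinate over the first is independent of it with law `excessMeasure γ δ`. -/
noncomputable def limitLaw (γ δ u : ℝ) : Measure Plane :=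
  (((expMeasure 1).map (u + ·)).prod (excessMeasure γ δ)).map ofMinExcess

variable {γ δ : ℝ}

lemma isProbabilityMeasure_limitLaw (hγ : 0 < γ) (hδ : 0 < δ) (u : ℝ) :
    IsProbabilityMeasure (limitLaw γ δ u) := by
  have := isProbabilityMeasure_expMeasure one_pos
  have := isProbabilityMeasure_excessMeasure hγ hδ
  have := Measure.isProbabilityMeasure_map (μ := expMeasure 1)
    (measurable_const_add u).aemeasurable
  exact Measure.isProbabilityMeasure_map measurable_ofMinExcess.aemeasurable

lemma preimage_ofMinExcess_quadrant (u : ℝ) :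
    ofMinExcess ⁻¹' quadrant u = Set.Ici u ×ˢ Set.univ := by
  ext p
  simp [ofMinExcess_mem_quadrant]

theorem restrict_intensityMeasure_quadrant (hγ : 0 < γ) (hδ : 0 < δ) (u : ℝ) :
    (intensityMeasure γ δ).restrict (quadrant u) =
      ENNReal.ofReal (Real.exp (-u)) • limitLaw γ δ u := by
  have := isProbabilityMeasure_excessMeasure hγ hδ
  rw [intensityMeasure_eq_map_prod hγ hδ,
    Measure.restrict_map measurable_ofMinExcess (measurableSet_quadrant u),
    preimage_ofMinExcess_quadrant, ← Measure.prod_restrict, Measure.restrict_univ,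
    restrict_Ici_withDensity_exp_neg, Measure.prod_smul_left, Measure.map_smul, limitLaw]

lemma ae_mem_quadrant_limitLaw (hγ : 0 < γ) (hδ : 0 < δ) (u : ℝ) :
    ∀ᵐ z ∂limitLaw γ δ u, z ∈ quadrant u := by
  have := ae_restrict_mem (μ := intensityMeasure γ δ) (measurableSet_quadrant u)
  rwa [restrict_intensityMeasure_quadrant hγ hδ, Measure.ae_ennreal_smul_measure_iff] at this
  simp [Real.exp_pos]

lemma limitMeanMeasure_eq_smul (hγ : 0 < γ) (hδ : 0 < δ) (u : ℝ) :
    limitMeanMeasure γ δ u = (Real.exp (-u)).toNNReal • (limitLaw γ δ u).comap Subtype.val :=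
  comap_val_eq_smul (measurableSet_quadrant u) (restrict_intensityMeasure_quadrant hγ hδ u)

lemma measurePreserving_val_limitLaw (hγ : 0 < γ) (hδ : 0 < δ) (u : ℝ) :
    MeasurePreserving (Subtype.val : quadrant u → Plane)
      ((limitLaw γ δ u).comap Subtype.val) (limitLaw γ δ u) := by
  refine ⟨measurable_subtype_coe, ?_⟩
  rw [map_comap_subtype_coe (measurableSet_quadrant u),
    Measure.restrict_eq_self_of_ae_mem (ae_mem_quadrant_limitLaw hγ hδ u)]

lemma isProbabilityMeasure_comap_limitLaw (hγ : 0 < γ) (hδ : 0 < δ) (u : ℝ) :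
    IsProbabilityMeasure ((limitLaw γ δ u).comap (Subtype.val : quadrant u → Plane)) := by
  have := isProbabilityMeasure_limitLaw hγ hδ u
  rw [← (measurePreserving_val_limitLaw hγ hδ u).map_eq] at this
  exact Measure.isProbabilityMeasure_of_map Subtype.val

lemma lintegral_abs_sub_limitLaw (hγ : 0 < γ) (hδ : 0 < δ) (u : ℝ) :
    ∫⁻ z, ENNReal.ofReal |z 1 - z 0| ∂limitLaw γ δ u =
      ENNReal.ofReal (γ / (1 + δ) + δ / (1 + γ)) := by
  have := isProbabilityMeasure_expMeasure one_pos
  have := isProbabilityMeasure_excessMeasure hγ hδ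
  have := Measure.isProbabilityMeasure_map (μ := expMeasure 1)
    (measurable_const_add u).aemeasurable
  have h (i : Fin 2) := measurable_coord i
  rw [limitLaw, lintegral_map (by fun_prop) measurable_ofMinExcess]
  simp_rw [ofMinExcess_one_sub_zero]
  rw [lintegral_prod _ (by fun_prop)]
  simp [lintegral_abs_excessMeasure hγ hδ]

lemma integrable_abs_sub_limitLaw (hγ : 0 < γ) (hδ : 0 < δ) (u : ℝ) :
    Integrable (fun z : Plane ↦ |z 1 - z 0|) (limitLaw γ δ u) := by
  have h (i : Fin 2) := measurable_coord i
  rw [← lintegral_ofReal_ne_top_iff_integrable (by fun_prop) (.of_forall fun _ ↦ abs_nonneg _),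
    lintegral_abs_sub_limitLaw hγ hδ]
  exact ENNReal.ofReal_ne_top

lemma integral_abs_sub_limitLaw (hγ : 0 < γ) (hδ : 0 < δ) (u : ℝ) :
    ∫ z, |z 1 - z 0| ∂limitLaw γ δ u = γ / (1 + δ) + δ / (1 + γ) := by
  have h (i : Fin 2) := measurable_coord i
  rw [integral_eq_lintegral_of_nonneg_ae (.of_forall fun _ ↦ abs_nonneg _) (by fun_prop),
    lintegral_abs_sub_limitLaw hγ hδ, ENNReal.toReal_ofReal (by positivity)]

end LimitLaw

section Lattice

/-- The lattice point attached to a point `z` of `[u, ∞)²`: the excess of the smaller coordinate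
over `u` is rounded down to a multiple of `r`, and the signed excess of the second coordinate over
the first is rounded away from `0` by `excessCell`. -/
noncomputable def latticePoint (r κ₁ κ₂ u : ℝ) (z : Plane) : ℕ × ℕ :=
  (⌊(min (z 0) (z 1) - u) / r⌋₊, ⌊(min (z 0) (z 1) - u) / r⌋₊) + excessCell κ₁ κ₂ (z 1 - z 0)

variable {γ δ p₁₁ q₁ q₂ p₀₀ r κ₁ κ₂ : ℝ}

lemma measurable_latticePoint (r κ₁ κ₂ u : ℝ) : Measurable (latticePoint r κ₁ κ₂ u) := by
  have h (i : Fin 2) := measurable_coord i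
  have hfloor : Measurable fun z : Plane ↦ ⌊(min (z 0) (z 1) - u) / r⌋₊ :=
    Nat.measurable_floor.comp (by fun_prop)
  exact (hfloor.prodMk hfloor).add ((measurable_excessCell κ₁ κ₂).comp (by fun_prop))

lemma diag_add_eq_diag_add_iff {m m' : ℕ} {c c' : ℕ × ℕ} (hc : c.1 = 0 ∨ c.2 = 0)
    (hc' : c'.1 = 0 ∨ c'.2 = 0) : (m, m) + c = (m', m') + c' ↔ m = m' ∧ c = c' := by
  simp only [Prod.ext_iff, Prod.fst_add, Prod.snd_add]
  omega

lemma preimage_latticePoint (hκ₁ : 0 < κ₁) (hκ₂ : 0 < κ₂) (u : ℝ) (m : ℕ) {c : ℕ × ℕ}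
    (hc : c.1 = 0 ∨ c.2 = 0) :
    ofMinExcess ⁻¹' (latticePoint r κ₁ κ₂ u ⁻¹' {(m, m) + c}) =
      {s | ⌊(s - u) / r⌋₊ = m} ×ˢ (excessCell κ₁ κ₂ ⁻¹' {c}) := by
  ext p
  rw [Set.mem_preimage, Set.mem_preimage, Set.mem_singleton_iff, latticePoint, min_ofMinExcess,
    ofMinExcess_one_sub_zero,
    diag_add_eq_diag_add_iff (excessCell_fst_eq_zero_or_snd_eq_zero hκ₁ hκ₂ p.2) hc]
  rfl

lemma limitLaw_preimage_latticePoint (hγ : 0 < γ) (hδ : 0 < δ) (hr : 0 < r) (hκ₁ : 0 < κ₁)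
    (hκ₂ : 0 < κ₂) (u : ℝ) (m : ℕ) {c : ℕ × ℕ} (hc : c.1 = 0 ∨ c.2 = 0) :
    limitLaw γ δ u (latticePoint r κ₁ κ₂ u ⁻¹' {(m, m) + c}) =
      ENNReal.ofReal (Real.exp (-r) ^ m * (1 - Real.exp (-r))) *
        excessMeasure γ δ (excessCell κ₁ κ₂ ⁻¹' {c}) := by
  have := isProbabilityMeasure_excessMeasure hγ hδ
  have hfloor : MeasurableSet {s | ⌊(s - u) / r⌋₊ = m} :=
    (Nat.measurable_floor.comp (by fun_prop : Measurable fun s ↦ (s - u) / r))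
      (measurableSet_singleton m)
  rw [limitLaw, Measure.map_apply measurable_ofMinExcess
    (measurable_latticePoint _ _ _ _ (measurableSet_singleton _)),
    preimage_latticePoint hκ₁ hκ₂ u m hc, Measure.prod_prod,
    Measure.map_apply (measurable_const_add u) hfloor]
  simpa using congrArg (· * _) (expMeasure_floor_div one_pos hr m)

lemma eq_diag_or_above_or_below (x : ℕ × ℕ) :
    (∃ m, x = (m, m)) ∨ (∃ m j, x = (m, m + (j + 1))) ∨ ∃ m i, x = (m + (i + 1), m) := by
  obtain ⟨k, l⟩ := x
  rcases lt_trichotomy k l with h | rfl | h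
  · obtain ⟨j, rfl⟩ := Nat.exists_eq_add_of_lt h
    exact .inr (.inl ⟨k, j, rfl⟩)
  · exact .inl ⟨k, rfl⟩
  · obtain ⟨i, rfl⟩ := Nat.exists_eq_add_of_lt h
    exact .inr (.inr ⟨l, i, rfl⟩)

theorem map_latticePoint_limitLaw (hγ : 0 < γ) (hδ : 0 < δ) (hr : 0 < r) (hκ₁ : 0 < κ₁)
    (hκ₂ : 0 < κ₂) (hq₁ : q₁ = 1 - (1 + γ) * p₁₁) (hq₂ : q₂ = 1 - (1 + δ) * p₁₁)
    (hp₀₀ : p₀₀ = 1 - (1 + γ + δ) * p₁₁) (hexp_r : Real.exp (-r) = p₀₀)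
    (hexp_κ₁ : Real.exp (-((1 + γ) / (1 + γ + δ) * κ₁)) = q₁)
    (hexp_κ₂ : Real.exp (-((1 + δ) / (1 + γ + δ) * κ₂)) = q₂) (u : ℝ) :
    (limitLaw γ δ u).map (latticePoint r κ₁ κ₂ u) = geometricLaw q₁ q₂ p₀₀ := by
  have hM : 1 + γ + δ ≠ 0 := by positivity
  have hq₁_ne : q₁ ≠ 0 := hexp_κ₁ ▸ (Real.exp_pos _).ne'
  have hq₂_ne : q₂ ≠ 0 := hexp_κ₂ ▸ (Real.exp_pos _).ne'
  have hmass (m : ℕ) : 0 ≤ p₀₀ ^ m * (1 - p₀₀) := by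
    rw [← hexp_r]
    exact mul_nonneg (by positivity) (sub_nonneg.2 (Real.exp_le_one_iff.2 (by linarith)))
  refine Measure.ext_of_singleton fun x ↦ ?_
  rw [geometricLaw_singleton, Measure.map_apply (measurable_latticePoint _ _ _ _)
    (measurableSet_singleton x)]
  rcases eq_diag_or_above_or_below x with ⟨m, rfl⟩ | ⟨m, j, rfl⟩ | ⟨m, i, rfl⟩
  · have cell := limitLaw_preimage_latticePoint hγ hδ hr hκ₁ hκ₂ u m (c := (0, 0)) (.inl rfl)
    rwa [excessMeasure_excessCell_zero hγ hδ hκ₁ hκ₂, hexp_r, ← ENNReal.ofReal_mul (hmass m),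
      ← geometricPMF_diag hM hq₁ hq₂ hp₀₀] at cell
  · have cell := limitLaw_preimage_latticePoint hγ hδ hr hκ₁ hκ₂ u m (c := (0, j + 1)) (.inl rfl)
    rwa [excessMeasure_excessCell_snd hγ hδ hκ₁ hκ₂, hexp_r, hexp_κ₂,
      ← ENNReal.ofReal_mul (by positivity), ← ENNReal.ofReal_mul (hmass m),
      ← geometricPMF_above_diag hM hq₂ hp₀₀ hq₂_ne q₁] at cell
  · have cell := limitLaw_preimage_latticePoint hγ hδ hr hκ₁ hκ₂ u m (c := (i + 1, 0)) (.inr rfl)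
    rwa [excessMeasure_excessCell_fst hγ hδ hκ₁ hκ₂, hexp_r, hexp_κ₁,
      ← ENNReal.ofReal_mul (by positivity), ← ENNReal.ofReal_mul (hmass m),
      ← geometricPMF_below_diag hM hq₁ hp₀₀ hq₁_ne q₂] at cell

end Lattice

section CellWidth

lemma le_log_one_div_one_sub {x : ℝ} (hx : x < 1) : x ≤ Real.log (1 / (1 - x)) := by
  rw [one_div, Real.log_inv]
  linarith [Real.log_le_sub_one_of_pos (sub_pos.2 hx)]

lemma log_one_div_one_sub_le {x : ℝ} (hx : x < 1) : Real.log (1 / (1 - x)) ≤ x / (1 - x) := by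
  have hx' : 0 < 1 - x := sub_pos.2 hx
  refine (Real.log_le_sub_one_of_pos (one_div_pos.2 hx')).trans_eq ?_
  field_simp
  ring

lemma exp_neg_log_one_div {q : ℝ} (hq : 0 < q) : Real.exp (-Real.log (1 / q)) = q := by
  rw [one_div, Real.log_inv, neg_neg, Real.exp_log hq]

lemma log_one_div_pos {q : ℝ} (hq : 0 < q) (hq1 : q < 1) : 0 < Real.log (1 / q) :=
  Real.log_pos (one_lt_one_div hq hq1)

/-- The width of the intervals for which an exponential variable of rate `β`, rounded to a
multiple of this width, becomes geometric with failure probability `q`. -/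
noncomputable def cellWidth (β q : ℝ) : ℝ := Real.log (1 / q) / β

lemma cellWidth_pos {β q : ℝ} (hβ : 0 < β) (hq : 0 < q) (hq1 : q < 1) : 0 < cellWidth β q :=
  div_pos (log_one_div_pos hq hq1) hβ

lemma exp_neg_mul_cellWidth {β q : ℝ} (hβ : β ≠ 0) (hq : 0 < q) :
    Real.exp (-(β * cellWidth β q)) = q := by
  rw [cellWidth, mul_div_cancel₀ _ hβ, exp_neg_log_one_div hq]

lemma abs_log_div_cellWidth_sub_one_le {x t : ℝ} (hx : 0 < x) (hx1 : x < 1) (ht : 0 < t)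
    (ht1 : t ≤ 1) :
    |Real.log (1 / (1 - x)) / cellWidth t (1 - t * x) - 1| ≤ x / (1 - x) := by
  have hx' : 0 < 1 - x := sub_pos.2 hx1
  have htx : t * x ≤ x := mul_le_of_le_one_left hx.le ht1
  have le_r := le_log_one_div_one_sub hx1
  have r_le := log_one_div_one_sub_le hx1
  have le_s := le_log_one_div_one_sub (htx.trans_lt hx1)
  have s_le := log_one_div_one_sub_le (htx.trans_lt hx1)
  rw [cellWidth]
  set r := Real.log (1 / (1 - x))
  set s := Real.log (1 / (1 - t * x))
  have hs : 0 < s := (mul_pos ht hx).trans_le le_s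
  rw [le_div_iff₀ hx'] at r_le
  rw [le_div_iff₀ (by linarith)] at s_le
  have ratio : r / (s / t) - 1 = (r * t - s) / s := by field_simp
  rw [ratio, abs_div, abs_of_pos hs, div_le_div_iff₀ hs hx', ← abs_of_pos hx', ← abs_mul, abs_le]
  have s_mul_le : s * (1 - x) ≤ t * x := by nlinarith
  have le_rt : t * x * (1 - x) ≤ r * t * (1 - x) := by
    rw [mul_comm r]
    gcongr
  have rt_le : r * t * (1 - x) ≤ x * t := by nlinarith
  have : t * x * x ≤ s * x := mul_le_mul_of_nonneg_right le_s hx.le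
  constructor <;> linarith

end CellWidth

section Threshold

/-- The least `k` for which the normalised point `(k, k)` lies in `[u, ∞)²`. -/
noncomputable def threshold (n : ℕ) (p₀₀ u : ℝ) : ℕ :=
  ⌈(u + Real.log n) / Real.log (1 / p₀₀)⌉₊

variable {n : ℕ} {p₀₀ u : ℝ}

lemma threshold_le_iff (hp₀₀ : 0 < p₀₀) (hp₀₀1 : p₀₀ < 1) {j : ℕ} :
    threshold n p₀₀ u ≤ j ↔ u ≤ j * Real.log (1 / p₀₀) - Real.log n := by
  rw [threshold, Nat.ceil_le, div_le_iff₀ (log_one_div_pos hp₀₀ hp₀₀1), le_sub_iff_add_le]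

lemma normalise_mem_quadrant_iff (hp₀₀ : 0 < p₀₀) (hp₀₀1 : p₀₀ < 1) {x : ℕ × ℕ} :
    normalise n p₀₀ x ∈ quadrant u ↔ threshold n p₀₀ u ≤ x.1 ∧ threshold n p₀₀ u ≤ x.2 := by
  rw [threshold_le_iff hp₀₀ hp₀₀1, threshold_le_iff hp₀₀ hp₀₀1]
  rfl

lemma threshold_mul_le (hp₀₀ : 0 < p₀₀) (hp₀₀1 : p₀₀ < 1) (hu : -Real.log n ≤ u) :
    threshold n p₀₀ u * Real.log (1 / p₀₀) ≤ u + Real.log n + Real.log (1 / p₀₀) := by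
  have hr := log_one_div_pos hp₀₀ hp₀₀1
  have hu' : 0 ≤ u + Real.log n := by linarith
  have lt := Nat.ceil_lt_add_one (div_nonneg hu' hr.le)
  rw [← sub_lt_iff_lt_add, lt_div_iff₀ hr, sub_one_mul] at lt
  exact (sub_lt_iff_lt_add.1 lt).le

lemma exp_neg_add_log (hn : n ≠ 0) (u : ℝ) :
    Real.exp (-(u + Real.log n)) = Real.exp (-u) / n := by
  rw [neg_add, Real.exp_add, Real.exp_neg (Real.log n), Real.exp_log (by positivity),
    div_eq_mul_inv]

lemma pow_eq_exp_neg_mul_log (hp₀₀ : 0 < p₀₀) (k : ℕ) :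
    p₀₀ ^ k = Real.exp (-(k * Real.log (1 / p₀₀))) := by
  rw [← mul_neg, Real.exp_nat_mul, exp_neg_log_one_div hp₀₀]

lemma pow_threshold_le (hn : n ≠ 0) (hp₀₀ : 0 < p₀₀) (hp₀₀1 : p₀₀ < 1) :
    p₀₀ ^ threshold n p₀₀ u ≤ Real.exp (-u) / n := by
  have le := (threshold_le_iff hp₀₀ hp₀₀1).1 (le_refl (threshold n p₀₀ u))
  rw [pow_eq_exp_neg_mul_log hp₀₀, ← exp_neg_add_log hn, Real.exp_le_exp]
  linarith

lemma le_pow_threshold (hn : n ≠ 0) (hp₀₀ : 0 < p₀₀) (hp₀₀1 : p₀₀ < 1) (hu : -Real.log n ≤ u) :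
    p₀₀ * (Real.exp (-u) / n) ≤ p₀₀ ^ threshold n p₀₀ u := by
  have le := threshold_mul_le hp₀₀ hp₀₀1 hu
  nth_rw 1 [← exp_neg_log_one_div hp₀₀]
  rw [pow_eq_exp_neg_mul_log hp₀₀, ← exp_neg_add_log hn, ← Real.exp_add, Real.exp_le_exp]
  linarith

lemma mul_pow_threshold_le (hn : n ≠ 0) (hp₀₀ : 0 < p₀₀) (hp₀₀1 : p₀₀ < 1) :
    n * p₀₀ ^ threshold n p₀₀ u ≤ Real.exp (-u) :=
  (le_div_iff₀' (by positivity)).1 (pow_threshold_le hn hp₀₀ hp₀₀1)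

lemma le_mul_pow_threshold (hn : n ≠ 0) (hp₀₀ : 0 < p₀₀) (hp₀₀1 : p₀₀ < 1)
    (hu : -Real.log n ≤ u) : p₀₀ * Real.exp (-u) ≤ n * p₀₀ ^ threshold n p₀₀ u := by
  have le := le_pow_threshold hn hp₀₀ hp₀₀1 hu
  rwa [← mul_div_assoc, div_le_iff₀' (by positivity)] at le

end Threshold

section Discretise

/-- Moves a point of `[u, ∞)²` to a nearby point of the normalised lattice, such that `limitLaw`
is taken to the law of a normalised geometric pair conditioned to lie in `[u, ∞)²`. -/
noncomputable def discretise (n : ℕ) (p₀₀ κ₁ κ₂ u : ℝ) (z : Plane) : Plane :=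
  normalise n p₀₀ (latticePoint (Real.log (1 / p₀₀)) κ₁ κ₂ u z +
    (threshold n p₀₀ u, threshold n p₀₀ u))

variable {n : ℕ} {γ δ p₁₁ q₁ q₂ p₀₀ κ₁ κ₂ u ε r : ℝ}

lemma measurable_normalise (n : ℕ) (p₀₀ : ℝ) : Measurable (normalise n p₀₀) := .of_discrete

lemma measurable_discretise (n : ℕ) (p₀₀ κ₁ κ₂ u : ℝ) :
    Measurable (discretise n p₀₀ κ₁ κ₂ u) :=
  (measurable_normalise n p₀₀).comp ((measurable_latticePoint _ _ _ _).add_const _)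

lemma mapsTo_discretise (hp₀₀ : 0 < p₀₀) (hp₀₀1 : p₀₀ < 1) (n : ℕ) (κ₁ κ₂ u : ℝ) :
    Set.MapsTo (discretise n p₀₀ κ₁ κ₂ u) (quadrant u) (quadrant u) := fun _ _ ↦
  (normalise_mem_quadrant_iff hp₀₀ hp₀₀1).2 ⟨Nat.le_add_left _ _, Nat.le_add_left _ _⟩

/-- The map `discretise`, as a map of `[u, ∞)²` to itself. -/
noncomputable def discretiseQuadrant (hp₀₀ : 0 < p₀₀) (hp₀₀1 : p₀₀ < 1) (n : ℕ) (κ₁ κ₂ u : ℝ) :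
    quadrant u → quadrant u :=
  (mapsTo_discretise hp₀₀ hp₀₀1 n κ₁ κ₂ u).restrict

lemma measurable_discretiseQuadrant (hp₀₀ : 0 < p₀₀) (hp₀₀1 : p₀₀ < 1) (n : ℕ) (κ₁ κ₂ u : ℝ) :
    Measurable (discretiseQuadrant hp₀₀ hp₀₀1 n κ₁ κ₂ u) :=
  ((measurable_discretise n p₀₀ κ₁ κ₂ u).comp measurable_subtype_coe).subtype_mk

theorem restrict_map_normalise_geometricLaw (hγ : 0 < γ) (hδ : 0 < δ)
    (hκ₁ : 0 < κ₁) (hκ₂ : 0 < κ₂) (hq₁ : q₁ = 1 - (1 + γ) * p₁₁)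
    (hq₂ : q₂ = 1 - (1 + δ) * p₁₁) (hp₀₀ : p₀₀ = 1 - (1 + γ + δ) * p₁₁) (hp₀₀_pos : 0 < p₀₀)
    (hp₀₀_lt : p₀₀ < 1) (hexp_κ₁ : Real.exp (-((1 + γ) / (1 + γ + δ) * κ₁)) = q₁)
    (hexp_κ₂ : Real.exp (-((1 + δ) / (1 + γ + δ) * κ₂)) = q₂) (n : ℕ) (u : ℝ) :
    ((geometricLaw q₁ q₂ p₀₀).map (normalise n p₀₀)).restrict (quadrant u) =
      ENNReal.ofReal (p₀₀ ^ threshold n p₀₀ u) •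
        (limitLaw γ δ u).map (discretise n p₀₀ κ₁ κ₂ u) := by
  set k := threshold n p₀₀ u
  have preimage : normalise n p₀₀ ⁻¹' quadrant u = {x | k ≤ x.1 ∧ k ≤ x.2} :=
    Set.ext fun _ ↦ normalise_mem_quadrant_iff hp₀₀_pos hp₀₀_lt
  rw [Measure.restrict_map (measurable_normalise n p₀₀) (measurableSet_quadrant u), preimage,
    restrict_geometricLaw hp₀₀_pos.le, Measure.map_smul,
    Measure.map_map (measurable_normalise n p₀₀) .of_discrete,
    ← map_latticePoint_limitLaw hγ hδ (log_one_div_pos hp₀₀_pos hp₀₀_lt) hκ₁ hκ₂ hq₁ hq₂ hp₀₀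
      (exp_neg_log_one_div hp₀₀_pos) hexp_κ₁ hexp_κ₂ u,
    Measure.map_map .of_discrete (measurable_latticePoint _ _ _ _)]
  rfl

lemma abs_mul_ceil_sub_le {κ y : ℝ} (hr : 0 ≤ r) (hκ : 0 < κ) (hε : |r / κ - 1| ≤ ε)
    (hy : 0 ≤ y) : |r * ⌈y / κ⌉₊ - y| ≤ r + ε * y := by
  have ceil_sub : |⌈y / κ⌉₊ - y / κ| ≤ 1 := by
    rw [abs_of_nonneg (sub_nonneg.2 (Nat.le_ceil _)), sub_le_iff_le_add']
    exact (Nat.ceil_lt_add_one (by positivity)).le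
  calc |r * ⌈y / κ⌉₊ - y| = |r * (⌈y / κ⌉₊ - y / κ) + (r / κ - 1) * y| := by ring_nf
    _ ≤ |r * (⌈y / κ⌉₊ - y / κ)| + |(r / κ - 1) * y| := abs_add_le _ _
    _ ≤ r + ε * y := by
      rw [abs_mul, abs_mul, abs_of_nonneg hr, abs_of_nonneg hy]
      gcongr
      exact mul_le_of_le_one_right hr ceil_sub

lemma abs_mul_excessCell_sub_le_of_nonneg (hr : 0 ≤ r) (hκ₁ : 0 < κ₁) (hκ₂ : 0 < κ₂)
    (hε : |r / κ₂ - 1| ≤ ε) {y : ℝ} (hy : 0 ≤ y) :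
    |r * (excessCell κ₁ κ₂ y).1 - y⁻| + |r * (excessCell κ₁ κ₂ y).2 - y⁺| ≤ r + ε * |y| := by
  rw [excessCell_of_nonneg hκ₁ hy, posPart_of_nonneg hy, negPart_of_nonneg hy, abs_of_nonneg hy]
  simpa using abs_mul_ceil_sub_le hr hκ₂ hε hy

lemma abs_mul_excessCell_sub_le (hr : 0 ≤ r) (hκ₁ : 0 < κ₁) (hκ₂ : 0 < κ₂)
    (hε₁ : |r / κ₁ - 1| ≤ ε) (hε₂ : |r / κ₂ - 1| ≤ ε) (y : ℝ) :
    |r * (excessCell κ₁ κ₂ y).1 - y⁻| + |r * (excessCell κ₁ κ₂ y).2 - y⁺| ≤ r + ε * |y| := by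
  rcases le_total 0 y with hy | hy
  · exact abs_mul_excessCell_sub_le_of_nonneg hr hκ₁ hκ₂ hε₂ hy
  · have reflected := abs_mul_excessCell_sub_le_of_nonneg hr hκ₂ hκ₁ hε₁ (neg_nonneg.2 hy)
    rwa [excessCell_neg, negPart_neg, posPart_neg, abs_neg, add_comm] at reflected

lemma dist_le_abs_add_abs (z w : Plane) : dist z w ≤ |z 0 - w 0| + |z 1 - w 1| := by
  rw [EuclideanSpace.dist_eq, Fin.sum_univ_two, Real.dist_eq, Real.dist_eq]
  refine Real.sqrt_le_iff.2 ⟨by positivity, ?_⟩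
  nlinarith [mul_nonneg (abs_nonneg (z 0 - w 0)) (abs_nonneg (z 1 - w 1))]

lemma abs_floor_add_threshold_sub_le (hp₀₀ : 0 < p₀₀) (hp₀₀1 : p₀₀ < 1) (hu : -Real.log n ≤ u)
    {s : ℝ} (hs : u ≤ s) :
    |(⌊(s - u) / Real.log (1 / p₀₀)⌋₊ + threshold n p₀₀ u) * Real.log (1 / p₀₀) - Real.log n - s| ≤
      Real.log (1 / p₀₀) := by
  have hr := log_one_div_pos hp₀₀ hp₀₀1
  have le_threshold := (threshold_le_iff hp₀₀ hp₀₀1).1 (le_refl (threshold n p₀₀ u))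
  have threshold_le := threshold_mul_le hp₀₀ hp₀₀1 hu
  have floor_le := Nat.floor_le (div_nonneg (sub_nonneg.2 hs) hr.le)
  have lt_floor := Nat.lt_floor_add_one ((s - u) / Real.log (1 / p₀₀))
  rw [le_div_iff₀ hr] at floor_le
  rw [div_lt_iff₀ hr] at lt_floor
  rw [abs_le]
  constructor <;> linarith

lemma min_add_negPart_sub (a b : ℝ) : min a b + (b - a)⁻ = a := by
  rcases le_total a b with h | h
  · rw [min_eq_left h, negPart_of_nonneg (sub_nonneg.2 h), add_zero]
  · rw [min_eq_right h, negPart_of_nonpos (sub_nonpos.2 h), neg_sub, add_sub_cancel]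

lemma min_add_posPart_sub (a b : ℝ) : min a b + (b - a)⁺ = b := by
  rw [min_comm, ← neg_sub, posPart_neg, min_add_negPart_sub]

theorem dist_discretise_le (hp₀₀ : 0 < p₀₀) (hp₀₀1 : p₀₀ < 1) (hκ₁ : 0 < κ₁)
    (hκ₂ : 0 < κ₂) (hε₁ : |Real.log (1 / p₀₀) / κ₁ - 1| ≤ ε)
    (hε₂ : |Real.log (1 / p₀₀) / κ₂ - 1| ≤ ε) (hu : -Real.log n ≤ u) {z : Plane}
    (hz : z ∈ quadrant u) :
    dist (discretise n p₀₀ κ₁ κ₂ u z) z ≤ 3 * Real.log (1 / p₀₀) + ε * |z 1 - z 0| := by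
  have base := abs_floor_add_threshold_sub_le hp₀₀ hp₀₀1 hu (le_min hz.1 hz.2)
  have excess :=
    abs_mul_excessCell_sub_le (log_one_div_pos hp₀₀ hp₀₀1).le hκ₁ hκ₂ hε₁ hε₂ (z 1 - z 0)
  set r := Real.log (1 / p₀₀)
  set c := excessCell κ₁ κ₂ (z 1 - z 0)
  set m := ⌊(min (z 0) (z 1) - u) / r⌋₊
  set a := (m + threshold n p₀₀ u) * r - Real.log n - min (z 0) (z 1)
  have coord_zero : discretise n p₀₀ κ₁ κ₂ u z 0 - z 0 = a + (r * c.1 - (z 1 - z 0)⁻) := by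
    have : discretise n p₀₀ κ₁ κ₂ u z 0 =
      ((m + c.1 + threshold n p₀₀ u : ℕ) : ℝ) * r - Real.log n := rfl
    rw [this]
    push_cast
    linear_combination min_add_negPart_sub (z 0) (z 1)
  have coord_one : discretise n p₀₀ κ₁ κ₂ u z 1 - z 1 = a + (r * c.2 - (z 1 - z 0)⁺) := by
    have : discretise n p₀₀ κ₁ κ₂ u z 1 =
      ((m + c.2 + threshold n p₀₀ u : ℕ) : ℝ) * r - Real.log n := rfl
    rw [this]
    push_cast
    linear_combination min_add_posPart_sub (z 0) (z 1)
  have dist_le := dist_le_abs_add_abs (discretise n p₀₀ κ₁ κ₂ u z) z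
  rw [coord_zero, coord_one] at dist_le
  linarith [abs_add_le a (r * c.1 - (z 1 - z 0)⁻), abs_add_le a (r * c.2 - (z 1 - z 0)⁺)]

end Discretise

section Approximation

open PointProcess

variable {n : ℕ} {γ δ p₁₁ q₁ q₂ p₀₀ κ₁ κ₂ u ε : ℝ}

lemma comap_map_normalise_geometricLaw (hγ : 0 < γ) (hδ : 0 < δ)
    (hκ₁ : 0 < κ₁) (hκ₂ : 0 < κ₂) (hq₁ : q₁ = 1 - (1 + γ) * p₁₁)
    (hq₂ : q₂ = 1 - (1 + δ) * p₁₁) (hp₀₀ : p₀₀ = 1 - (1 + γ + δ) * p₁₁) (hp₀₀_pos : 0 < p₀₀)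
    (hp₀₀_lt : p₀₀ < 1) (hexp_κ₁ : Real.exp (-((1 + γ) / (1 + γ + δ) * κ₁)) = q₁)
    (hexp_κ₂ : Real.exp (-((1 + δ) / (1 + γ + δ) * κ₂)) = q₂) (n : ℕ) (u : ℝ) :
    ((geometricLaw q₁ q₂ p₀₀).map (normalise n p₀₀)).comap Subtype.val =
      (p₀₀ ^ threshold n p₀₀ u).toNNReal • ((limitLaw γ δ u).comap Subtype.val).map
        (discretiseQuadrant hp₀₀_pos hp₀₀_lt n κ₁ κ₂ u) := by
  have hA := measurableSet_quadrant u
  rw [comap_val_eq_smul hA (restrict_map_normalise_geometricLaw hγ hδ hκ₁ hκ₂ hq₁ hq₂ hp₀₀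
    hp₀₀_pos hp₀₀_lt hexp_κ₁ hexp_κ₂ n u), comap_val_map hA (ae_mem_quadrant_limitLaw hγ hδ u)
    (measurable_discretise n p₀₀ κ₁ κ₂ u) (mapsTo_discretise hp₀₀_pos hp₀₀_lt n κ₁ κ₂ u)]
  rfl

lemma integral_d0_discretiseQuadrant_le (hγ : 0 < γ) (hδ : 0 < δ) (hp₀₀ : 0 < p₀₀)
    (hp₀₀1 : p₀₀ < 1) (hκ₁ : 0 < κ₁) (hκ₂ : 0 < κ₂) (hε₁ : |Real.log (1 / p₀₀) / κ₁ - 1| ≤ ε)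
    (hε₂ : |Real.log (1 / p₀₀) / κ₂ - 1| ≤ ε) (hu : -Real.log n ≤ u) :
    ∫ z, d0 (discretiseQuadrant hp₀₀ hp₀₀1 n κ₁ κ₂ u z) z ∂(limitLaw γ δ u).comap Subtype.val ≤
      3 * Real.log (1 / p₀₀) + ε * (γ / (1 + δ) + δ / (1 + γ)) := by
  have := isProbabilityMeasure_limitLaw hγ hδ u
  have hval := measurePreserving_val_limitLaw hγ hδ u
  have hint := (integrable_abs_sub_limitLaw hγ hδ u).const_mul ε
  have hbound : Integrable (fun z ↦ 3 * Real.log (1 / p₀₀) + ε * |z 1 - z 0|) (limitLaw γ δ u) :=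
    (integrable_const _).add hint
  calc ∫ z, d0 (discretiseQuadrant hp₀₀ hp₀₀1 n κ₁ κ₂ u z) z ∂(limitLaw γ δ u).comap Subtype.val
      ≤ ∫ z : quadrant u, (3 * Real.log (1 / p₀₀) + ε * |z.1 1 - z.1 0|)
          ∂(limitLaw γ δ u).comap Subtype.val :=
        integral_mono_of_nonneg (.of_forall fun _ ↦ d0_nonneg _ _)
          (hval.integrable_comp_of_integrable hbound) (.of_forall fun z ↦
            (min_le_left _ _).trans (dist_discretise_le hp₀₀ hp₀₀1 hκ₁ hκ₂ hε₁ hε₂ hu z.2))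
    _ = ∫ z, (3 * Real.log (1 / p₀₀) + ε * |z 1 - z 0|) ∂limitLaw γ δ u :=
        hval.integral_comp (.subtype_coe (measurableSet_quadrant u))
          fun z : Plane ↦ 3 * Real.log (1 / p₀₀) + ε * |z 1 - z 0|
    _ = 3 * Real.log (1 / p₀₀) + ε * (γ / (1 + δ) + δ / (1 + γ)) := by
        rw [integral_add (integrable_const _) hint, integral_const, probReal_univ, one_smul,
          integral_const_mul, integral_abs_sub_limitLaw hγ hδ]

lemma map_exceedanceProcess {Ω : Type*} [MeasurableSpace Ω] {P : Measure Ω}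
    [IsProbabilityMeasure P] {L : Measure (ℕ × ℕ)} {X : Fin n → Ω → ℕ × ℕ}
    (hX_law : ∀ i, HasLaw (X i) L P) (hX_indep : iIndepFun X P) (p₀₀ u : ℝ) :
    P.map (exceedanceProcess n p₀₀ u X) =
      (Measure.pi fun _ : Fin n ↦ L.map (normalise n p₀₀)).map (configIn (quadrant u)) := by
  have hXm (i : Fin n) : AEMeasurable (X i) P := (hX_law i).aemeasurable
  have hYm (i : Fin n) : AEMeasurable (fun ω ↦ normalise n p₀₀ (X i ω)) P :=
    (measurable_normalise n p₀₀).comp_aemeasurable (hXm i)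
  have hY_indep := hX_indep.comp _ fun _ ↦ measurable_normalise n p₀₀
  have hY_law (i : Fin n) : P.map (fun ω ↦ normalise n p₀₀ (X i ω)) = L.map (normalise n p₀₀) := by
    rw [← (hX_law i).map_eq,
      AEMeasurable.map_map_of_aemeasurable (measurable_normalise n p₀₀).aemeasurable (hXm i)]
    rfl
  rw [← funext hY_law, ← (iIndepFun_iff_map_fun_eq_pi_map hYm).1 hY_indep,
    AEMeasurable.map_map_of_aemeasurable
      (measurable_configIn (measurableSet_quadrant u) n).aemeasurable
      (aemeasurable_pi_lambda _ hYm)]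
  rfl

end Approximation

section Bounds

open PointProcess

variable {n : ℕ} {γ δ p₁₁ q₁ q₂ p₀₀ u : ℝ}

lemma abs_log_div_cellWidth_marginal_sub_one_le {M a : ℝ} (ha : 0 < a) (haM : a ≤ M)
    (hp₁₁ : 0 < p₁₁) (hMp : M * p₁₁ < 1) :
    |Real.log (1 / (1 - M * p₁₁)) / cellWidth (a / M) (1 - a * p₁₁) - 1| ≤
      M * p₁₁ / (1 - M * p₁₁) := by
  have hM : 0 < M := ha.trans_le haM
  have := abs_log_div_cellWidth_sub_one_le (mul_pos hM hp₁₁) hMp (div_pos ha hM)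
    ((div_le_one hM).2 haM)
  rwa [← mul_assoc, div_mul_cancel₀ _ hM.ne'] at this

lemma three_mul_add_mul_le {r ε : ℝ} (hγ : 0 ≤ γ) (hδ : 0 ≤ δ) (hε : 0 ≤ ε) (hr : r ≤ ε) :
    3 * r + ε * (γ / (1 + δ) + δ / (1 + γ)) ≤ 4 * ((1 + γ + δ) * ε) := by
  have hγ' : γ / (1 + δ) ≤ γ := div_le_self hγ (by linarith)
  have hδ' : δ / (1 + γ) ≤ δ := div_le_self hδ (by linarith)
  nlinarith [mul_le_mul_of_nonneg_left (add_le_add hγ' hδ') hε, mul_nonneg hγ hε, mul_nonneg hδ hε]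

theorem exists_comap_map_normalise_geometricLaw (hγ : 0 < γ) (hδ : 0 < δ) (hp₁₁ : 0 < p₁₁)
    (hq₁ : q₁ = 1 - (1 + γ) * p₁₁) (hq₂ : q₂ = 1 - (1 + δ) * p₁₁)
    (hp₀₀ : p₀₀ = 1 - (1 + γ + δ) * p₁₁) (hp₀₀_pos : 0 < p₀₀) (hu : -Real.log n ≤ u) :
    ∃ f : quadrant u → quadrant u, Measurable f ∧
      ((geometricLaw q₁ q₂ p₀₀).map (normalise n p₀₀)).comap Subtype.val =
        (p₀₀ ^ threshold n p₀₀ u).toNNReal • ((limitLaw γ δ u).comap Subtype.val).map f ∧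
      ∫ z, d0 (f z) z ∂(limitLaw γ δ u).comap Subtype.val ≤
        4 * ((1 + γ + δ) * ((1 + γ + δ) * p₁₁ / (1 - (1 + γ + δ) * p₁₁))) := by
  have hγp : 0 < γ * p₁₁ := mul_pos hγ hp₁₁
  have hδp : 0 < δ * p₁₁ := mul_pos hδ hp₁₁
  have hβ₁ : 0 < (1 + γ) / (1 + γ + δ) := by positivity
  have hβ₂ : 0 < (1 + δ) / (1 + γ + δ) := by positivity
  have hp₀₀_lt : p₀₀ < 1 := by linarith
  have hx : (1 + γ + δ) * p₁₁ < 1 := by linarith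
  have hq₁_pos : 0 < q₁ := by linarith
  have hq₂_pos : 0 < q₂ := by linarith
  have hκ₁ := cellWidth_pos hβ₁ hq₁_pos (by linarith)
  have hκ₂ := cellWidth_pos hβ₂ hq₂_pos (by linarith)
  have hε₁ := abs_log_div_cellWidth_marginal_sub_one_le (by positivity : 0 < 1 + γ)
    (le_add_of_nonneg_right hδ.le) hp₁₁ hx
  have hε₂ := abs_log_div_cellWidth_marginal_sub_one_le (by positivity : 0 < 1 + δ)
    (by linarith : 1 + δ ≤ 1 + γ + δ) hp₁₁ hx
  rw [← hp₀₀, ← hq₁] at hε₁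
  rw [← hp₀₀, ← hq₂] at hε₂
  have hr : Real.log (1 / p₀₀) ≤ (1 + γ + δ) * p₁₁ / p₀₀ := hp₀₀ ▸ log_one_div_one_sub_le hx
  refine ⟨discretiseQuadrant hp₀₀_pos hp₀₀_lt n _ _ u, measurable_discretiseQuadrant _ _ _ _ _ _,
    comap_map_normalise_geometricLaw hγ hδ hκ₁ hκ₂ hq₁ hq₂ hp₀₀ hp₀₀_pos hp₀₀_lt
      (exp_neg_mul_cellWidth hβ₁.ne' hq₁_pos) (exp_neg_mul_cellWidth hβ₂.ne' hq₂_pos) n u, ?_⟩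
  rw [← hp₀₀]
  exact (integral_d0_discretiseQuadrant_le hγ hδ hp₀₀_pos hp₀₀_lt hκ₁ hκ₂ hε₁ hε₂ hu).trans
    (three_mul_add_mul_le hγ.le hδ.le (by positivity) hr)

theorem d2_map_exceedanceProcess_le {Ω : Type*} [MeasurableSpace Ω] {P : Measure Ω}
    [IsProbabilityMeasure P] (hn : n ≠ 0) (hγ : 0 < γ) (hδ : 0 < δ) (hp₁₁ : 0 < p₁₁)
    (hq₁ : q₁ = 1 - (1 + γ) * p₁₁) (hq₂ : q₂ = 1 - (1 + δ) * p₁₁)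
    (hp₀₀ : p₀₀ = 1 - (1 + γ + δ) * p₁₁) (hp₀₀_pos : 0 < p₀₀) {X : Fin n → Ω → ℕ × ℕ}
    (hX_law : ∀ i, HasLaw (X i) (geometricLaw q₁ q₂ p₀₀) P) (hX_indep : iIndepFun X P)
    (hu : -Real.log n ≤ u) :
    d2 (P.map (exceedanceProcess n p₀₀ u X)) (PRM (limitMeanMeasure γ δ u)) ≤
      p₀₀ ^ threshold n p₀₀ u +
        min (Real.exp (-u) - n * p₀₀ ^ threshold n p₀₀ u)
          (√(Real.exp (-u)) - √(n * p₀₀ ^ threshold n p₀₀ u)) +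
        min (Real.exp (-u)) 1 *
          (4 * ((1 + γ + δ) * ((1 + γ + δ) * p₁₁ / (1 - (1 + γ + δ) * p₁₁)))) := by
  obtain ⟨f, hf, hcomap, hint⟩ := exists_comap_map_normalise_geometricLaw hγ hδ hp₁₁ hq₁ hq₂ hp₀₀
    hp₀₀_pos hu
  have hp₀₀_lt : p₀₀ < 1 := by rw [hp₀₀, sub_lt_self_iff]; positivity
  set p := p₀₀ ^ threshold n p₀₀ u
  have hp : p ∈ I := ⟨by positivity, pow_le_one₀ hp₀₀_pos.le hp₀₀_lt.le⟩
  have hnp : n * p ≤ Real.exp (-u) := mul_pow_threshold_le hn hp₀₀_pos hp₀₀_lt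
  have hgeo : IsProbabilityMeasure (geometricLaw q₁ q₂ p₀₀) :=
    (hX_law ⟨0, Nat.pos_of_ne_zero hn⟩).isProbabilityMeasure_iff.1 inferInstance
  have := Measure.isProbabilityMeasure_map (μ := geometricLaw q₁ q₂ p₀₀)
    (measurable_normalise n p₀₀).aemeasurable
  have := isProbabilityMeasure_comap_limitLaw hγ hδ u
  have hcomap' : ((geometricLaw q₁ q₂ p₀₀).map (normalise n p₀₀)).comap Subtype.val =
      unitInterval.toNNReal ⟨p, hp⟩ • ((limitLaw γ δ u).comap Subtype.val).map f := by
    rw [hcomap, Real.toNNReal_of_nonneg hp.1]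
    rfl
  have bound := d2_map_configIn_PRM_le (measurableSet_quadrant u) _ _ hf hcomap' (n := n)
    (b := (Real.exp (-u)).toNNReal)
    (by rw [← NNReal.coe_le_coe, Real.coe_toNNReal _ (Real.exp_nonneg _)]; exact hnp)
  rw [map_exceedanceProcess hX_law hX_indep, limitMeanMeasure_eq_smul hγ hδ]
  rw [Real.coe_toNNReal _ (Real.exp_nonneg _)] at bound
  refine bound.trans ?_
  gcongr

lemma min_one_le_min_mul_sqrt {b c : ℝ} (hb : 0 ≤ b) (hc : 1 ≤ c) : min b 1 ≤ min b (c * √b) := by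
  refine le_min (min_le_left _ _) (le_trans ?_ (le_mul_of_one_le_left (Real.sqrt_nonneg b) hc))
  rcases le_total b 1 with hb1 | hb1
  · exact (min_le_left _ _).trans (Real.le_sqrt_of_sq_le (pow_le_of_le_one hb hb1 two_ne_zero))
  · exact (min_le_right _ _).trans (Real.one_le_sqrt.2 hb1)

lemma min_sub_sqrt_sub_sqrt_le {a b c q : ℝ} (hb : 0 ≤ b) (hc : 1 ≤ c) (hq : 0 ≤ q)
    (hq1 : q ≤ 1) (hab : q * b ≤ a) : min (b - a) (√b - √a) ≤ (1 - q) * min b (c * √b) := by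
  have hq' : 0 ≤ 1 - q := sub_nonneg.2 hq1
  have hsqrt : q * √b ≤ √a := by
    refine Real.le_sqrt_of_sq_le (le_trans ?_ hab)
    rw [mul_pow, Real.sq_sqrt hb]
    gcongr
    exact pow_le_of_le_one hq hq1 two_ne_zero
  rw [mul_min_of_nonneg _ _ hq']
  refine min_le_min (by linarith) ?_
  calc √b - √a ≤ (1 - q) * √b := by linarith
    _ ≤ (1 - q) * (c * √b) := by gcongr; exact le_mul_of_one_le_left (Real.sqrt_nonneg b) hc

lemma le_mul_div_one_sub {M x : ℝ} (hM : 1 ≤ M) (hx : 0 ≤ x) (hx1 : x < 1) :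
    x ≤ M * (x / (1 - x)) :=
  have hx1' : 0 < 1 - x := sub_pos.2 hx1
  (le_div_self hx hx1' (by linarith)).trans (le_mul_of_one_le_left (by positivity) hM)

lemma mul_mul_div_one_sub_le {M p : ℝ} (hp : 0 ≤ p) (hM : 0 ≤ M) (hMp : M * p < 1) :
    M * (M * p / (1 - M * p)) ≤ M ^ 2 * p / (1 - M * p) ^ 3 := by
  rw [← mul_div_assoc, ← mul_assoc, ← sq]
  have hMp' : 0 < 1 - M * p := sub_pos.2 hMp
  gcongr
  exact pow_le_of_le_one hMp'.le (sub_le_self 1 (mul_nonneg hM hp)) three_ne_zero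

end Bounds

end MarshallOlkin

open MarshallOlkin PointProcess in
theorem corollaryt {Ω : Type*} [MeasurableSpace Ω] (P : Measure Ω) [IsProbabilityMeasure P]
    (n : ℕ) (hn : 1 ≤ n)
    (γ δ p₁₁ q₁ q₂ p₀₀ : ℝ) (hγ : 0 < γ) (hδ : 0 < δ) (hp₁₁ : p₁₁ ∈ Set.Ioo (0 : ℝ) 1)
    (hq₁ : q₁ = 1 - (1 + γ) * p₁₁) (hq₂ : q₂ = 1 - (1 + δ) * p₁₁)
    (hp₀₀ : p₀₀ = 1 - (1 + γ + δ) * p₁₁) (hp₀₀_pos : 0 < p₀₀)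
    (X : Fin n → Ω → ℕ × ℕ)
    (hX_law : ∀ i, HasLaw (X i) (MarshallOlkin.geometricLaw q₁ q₂ p₀₀) P)
    (hX_indep : iIndepFun X P)
    (u : ℝ) (hu : -Real.log n ≤ u) :
    PointProcess.d2 (P.map (MarshallOlkin.exceedanceProcess n p₀₀ u X))
        (PointProcess.PRM (MarshallOlkin.limitMeanMeasure γ δ u)) ≤
      Real.exp (-u) / n +
        (1 + γ + δ) ^ 2 * p₁₁ / (1 - (1 + γ + δ) * p₁₁) ^ 3 *
          (2 * √2 + 7 * min (Real.exp (-u)) (1.65 * Real.exp (-u / 2))) := by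
  have hn' : n ≠ 0 := Nat.one_le_iff_ne_zero.1 hn
  have hx : 0 < (1 + γ + δ) * p₁₁ := mul_pos (by positivity) hp₁₁.1
  have hx' : (1 + γ + δ) * p₁₁ < 1 := by linarith
  have hp₀₀_lt : p₀₀ < 1 := by linarith
  have coef_le := mul_mul_div_one_sub_le hp₁₁.1.le (by positivity) hx'
  have one_sub_le := le_mul_div_one_sub (by linarith : 1 ≤ 1 + γ + δ) hx.le hx'
  have min_one_le := min_one_le_min_mul_sqrt (Real.exp_nonneg (-u)) (c := 1.65) (by norm_num)
  have mean_gap := min_sub_sqrt_sub_sqrt_le (Real.exp_nonneg (-u)) (c := 1.65) (by norm_num)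
    hp₀₀_pos.le hp₀₀_lt.le (le_mul_pow_threshold hn' hp₀₀_pos hp₀₀_lt hu)
  rw [Real.exp_half (-u)]
  set c := (1 + γ + δ) ^ 2 * p₁₁ / (1 - (1 + γ + δ) * p₁₁) ^ 3
  set m := min (Real.exp (-u)) (1.65 * √(Real.exp (-u)))
  have hc : 0 ≤ c := hx.le.trans (one_sub_le.trans coef_le)
  have hm : 0 ≤ m := by positivity
  calc _ ≤ _ := d2_map_exceedanceProcess_le hn' hγ hδ hp₁₁.1 hq₁ hq₂ hp₀₀ hp₀₀_pos hX_law
        hX_indep hu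
    _ ≤ Real.exp (-u) / n + c * m + m * (4 * c) := by
      gcongr ?_ + ?_ + ?_ * (4 * ?_)
      · exact pow_threshold_le hn' hp₀₀_pos hp₀₀_lt
      · exact mean_gap.trans (by gcongr; linarith)
    _ ≤ _ := by linarith [mul_nonneg hc (Real.sqrt_nonneg 2), mul_nonneg hc hm]
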